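/- Let $p\ge 1$, $q\ge 2$ be integers with $p+q>4$, and put $n=p+q-2$. On $\mathbb{C}^{n+2}$ with basis $e_0,\dots,e_{n+1}$ consider the quadratic form $2x_0x_{n+1}+\sum_{i=1}^n\epsilon_i x_i^2$, where $\epsilon_i=1$ for $1\le i\le p-1$ and $\epsilon_i=-1$ for $p\le i\le n$. Let $\mathfrak g\simeq\mathfrak{so}(p,q)\otimes\mathbb{C}$ be the complex Lie algebra of matrices preserving this form infinitesimally, let $\mathfrak g'=\{X\in\mathfrak g: Xe_n=0\}\simeq\mathfrak{so}(p,q-1)\otimes\mathbb{C}$, let $\mathfrak p\subset\mathfrak g$ be the stabilizer of the line $\mathbb{C}e_0$, and let $\mathfrak p'=\mathfrak p\cap\mathfrak g'$. For $\lambda\in\mathbb{C}$ let $\mathbb{C}_\lambda$ be the one-dimensional representation of $\mathfrak p$ (and, by restriction, of $\mathfrak p'$) on which $X$ acts by $\lambda X_{00}$, where $X_{00}$ is the upper left entry of $X$, and let $$M^{\mathfrak g}_{\mathfrak p}(\lambda)=U(\mathfrak g)\otimes_{U(\mathfrak p)}\mathbb{C}_\lambda,\qquad M^{\mathfrak g'}_{\mathfrak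 p'}(\lambda)=U(\mathfrak g')\otimes_{U(\mathfrak p')}\mathbb{C}_\lambda$$ be the generalized Verma modules. For $j\in\mathbb{N}$ put $\lambda_j=\tfrac12(-n+1+j)$. Let $k\ge 1$ be an integer. (1) For $j=2k+1$ there is an isomorphism of $\mathfrak g'$-modules $$M^{\mathfrak g}_{\mathfrak p}(\lambda_{2k+1})|_{\mathfrak g'}\simeq\bigoplus_{b=0}^{\infty}M^{\mathfrak g'}_{\mathfrak p'}(\lambda_{2k+1}-b).$$ (2) For $j=2k$ there are $\mathfrak g'$-submodules $M_{a,2k-a}\subset M^{\mathfrak g}_{\mathfrak p}(\lambda_{2k})$, $a=0,\dots,k-1$, with the following two properties. The restriction $M^{\mathfrak g}_{\mathfrak p}(\lambda_{2k})|_{\mathfrak g'}$ is the (internal) direct sum of the submodules $M_{a,2k-a}$ $(0\le a\le k-1)$ and of $\mathfrak g'$-submodules isomorphic to the remaining summands in $$M^{\mathfrak g}_{\mathfrak p}(\lambda_{2k})|_{\mathfrak g'}\simeq\bigoplus_{a=0}^{k-1}M_{a,2k-a}\;\oplus\;M^{\mathfrak g'}_{\mathfrak p'}(\lambda_{2k}-k)\;\oplus\bigoplus_{b=2k+1}^{\infty}M^{\mathfrak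 g'}_{\mathfrak p'}(\lambda_{2k}-b).$$ For each $a=0,\dots,k-1$ there is a non-split exact sequence of $\mathfrak g'$-modules $$0\to M^{\mathfrak g'}_{\mathfrak p'}(\lambda_{2k}-a)\to M_{a,2k-a}\to M^{\mathfrak g'}_{\mathfrak p'}(\lambda_{2k}-(2k-a))\to 0.$$ -/

import Mathlib

open scoped TensorProduct DirectSum

attribute [local instance 100] LieRing.ofAssociativeRing

noncomputable section

/-! ### Generalized Verma modules -/

namespace GenVerma

variable {L : Type*} [LieRing L] [LieAlgebra ℂ L] (P : LieSubalgebra ℂ L)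
  {V : Type*} [AddCommGroup V] [Module ℂ V] (ρ : P →ₗ⁅ℂ⁆ Module.End ℂ V)

/-- The `U(L)`-submodule of `U(L) ⊗_ℂ V` spanned by the elements `u X ⊗ v - u ⊗ X v`
with `u ∈ U(L)`, `X ∈ P`, `v ∈ V`. As `U(P)` is generated by `P`, the quotient by it is the
tensor product over `U(P)`. -/
def balanced : Submodule (UniversalEnvelopingAlgebra ℂ L) (UniversalEnvelopingAlgebra ℂ L ⊗[ℂ] V) :=
  Submodule.span _ {t | ∃ (u : UniversalEnvelopingAlgebra ℂ L) (X : P) (v : V),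
    t = (u * UniversalEnvelopingAlgebra.ι ℂ (X : L)) ⊗ₜ[ℂ] v - u ⊗ₜ[ℂ] (ρ X v)}

end GenVerma

/-- The generalized Verma module `U(L) ⊗_{U(P)} V` induced from a representation `ρ` of a
subalgebra `P` on `V`. -/
def GenVerma {L : Type*} [LieRing L] [LieAlgebra ℂ L] (P : LieSubalgebra ℂ L)
    {V : Type*} [AddCommGroup V] [Module ℂ V] (ρ : P →ₗ⁅ℂ⁆ Module.End ℂ V) : Type _ :=
  (UniversalEnvelopingAlgebra ℂ L ⊗[ℂ] V) ⧸ GenVerma.balanced P ρ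

namespace GenVerma

variable {L : Type*} [LieRing L] [LieAlgebra ℂ L] (P : LieSubalgebra ℂ L)
  {V : Type*} [AddCommGroup V] [Module ℂ V] (ρ : P →ₗ⁅ℂ⁆ Module.End ℂ V)

instance : AddCommGroup (GenVerma P ρ) :=
  inferInstanceAs (AddCommGroup ((UniversalEnvelopingAlgebra ℂ L ⊗[ℂ] V) ⧸ balanced P ρ))

instance : Module (UniversalEnvelopingAlgebra ℂ L) (GenVerma P ρ) :=
  inferInstanceAs (Module (UniversalEnvelopingAlgebra ℂ L)
    ((UniversalEnvelopingAlgebra ℂ L ⊗[ℂ] V) ⧸ balanced P ρ))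

instance : Module ℂ (GenVerma P ρ) :=
  inferInstanceAs (Module ℂ ((UniversalEnvelopingAlgebra ℂ L ⊗[ℂ] V) ⧸ balanced P ρ))

instance : IsScalarTower ℂ (UniversalEnvelopingAlgebra ℂ L) (GenVerma P ρ) :=
  inferInstanceAs (IsScalarTower ℂ (UniversalEnvelopingAlgebra ℂ L)
    ((UniversalEnvelopingAlgebra ℂ L ⊗[ℂ] V) ⧸ balanced P ρ))

theorem ι_lie (x y : L) :
    UniversalEnvelopingAlgebra.ι ℂ ⁅x, y⁆ =
      UniversalEnvelopingAlgebra.ι ℂ x * UniversalEnvelopingAlgebra.ι ℂ y -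
        UniversalEnvelopingAlgebra.ι ℂ y * UniversalEnvelopingAlgebra.ι ℂ x := by
  rw [LieHom.map_lie, LieRing.of_associative_ring_bracket]

/-- The Lie algebra `L` acts through `L → U(L)`. -/
instance : LieRingModule L (GenVerma P ρ) where
  bracket x m := UniversalEnvelopingAlgebra.ι ℂ x • m
  add_lie x y m := by rw [map_add, add_smul]
  lie_add x m m' := smul_add _ m m'
  leibniz_lie x y m := by
    rw [ι_lie, sub_smul, mul_smul, mul_smul]; abel

instance : LieModule ℂ L (GenVerma P ρ) where
  smul_lie t x m := by
    change UniversalEnvelopingAlgebra.ι ℂ (t • x) • m = t • (UniversalEnvelopingAlgebra.ι ℂ x • m)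
    rw [map_smul, smul_assoc]
  lie_smul t x m := by
    change UniversalEnvelopingAlgebra.ι ℂ x • (t • m) = t • (UniversalEnvelopingAlgebra.ι ℂ x • m)
    rw [← algebraMap_smul (UniversalEnvelopingAlgebra ℂ L) t m, ← mul_smul,
      ← Algebra.commutes, mul_smul, algebraMap_smul]

end GenVerma

/-! ### The pair `(𝔰𝔬(n+2, ℂ), 𝔰𝔬(n+1, ℂ))`

Matrices are indexed by `0, 1, …, n + 1`. -/

namespace Conformal

/-- The Gram matrix of `2 x₀ xₙ₊₁ + ∑_{i=1}^n εᵢ xᵢ²` with `εᵢ = 1` for `1 ≤ i ≤ p - 1` and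
`εᵢ = -1` for `p ≤ i ≤ n`. For `1 ≤ p ≤ n + 1` it has signature `(p, n + 2 - p)`. -/
def gram (p n : ℕ) : Matrix (Fin (n + 2)) (Fin (n + 2)) ℂ := fun i j =>
  if (i = 0 ∧ j = Fin.last (n + 1)) ∨ (i = Fin.last (n + 1) ∧ j = 0) then 1
  else if i = j ∧ i ≠ 0 ∧ i ≠ Fin.last (n + 1) then (if (i : ℕ) < p then 1 else -1)
  else 0

/-- `𝔤`, the complexification of `𝔰𝔬(p, q)` with `p + q = n + 2`: complex matrices `X` with
`Xᵀ J + J X = 0`, where `J` is the real Gram matrix above. -/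
abbrev soG (p n : ℕ) : LieSubalgebra ℂ (Matrix (Fin (n + 2)) (Fin (n + 2)) ℂ) :=
  skewAdjointMatricesLieSubalgebra (gram p n)

/-- `𝔭 ⊆ 𝔤`, the stabilizer of the isotropic line `ℂ e₀`. -/
def parG (p n : ℕ) : LieSubalgebra ℂ (soG p n) where
  carrier := {X | ∀ i, i ≠ 0 → X.1 i 0 = 0}
  zero_mem' := by intro i _; simp
  add_mem' := by
    intro X Y hX hY i hi
    simp [hX i hi, hY i hi]
  smul_mem' := by
    intro c X hX i hi
    simp [hX i hi]
  lie_mem' := by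
    intro X Y hX hY i hi
    simp only [LieSubalgebra.coe_bracket, Ring.lie_def, Matrix.sub_apply, Matrix.mul_apply]
    rw [Finset.sum_eq_single 0 (fun j _ hj => by rw [hY j hj, mul_zero]) (by simp),
      Finset.sum_eq_single 0 (fun j _ hj => by rw [hX j hj, mul_zero]) (by simp),
      hX i hi, hY i hi]
    simp

/-- `𝔤' ⊆ 𝔤`, the annihilator of the basis vector `eₙ`: the complexification of
`𝔰𝔬(p, q - 1)`. -/
def soG' (p n : ℕ) : LieSubalgebra ℂ (soG p n) where
  carrier := {X | ∀ i, X.1 i (Fin.last n).castSucc = 0}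
  zero_mem' := by intro i; simp
  add_mem' := by
    intro X Y hX hY i
    simp [hX i, hY i]
  smul_mem' := by
    intro c X hX i
    simp [hX i]
  lie_mem' := by
    intro X Y hX hY i
    simp only [LieSubalgebra.coe_bracket, Ring.lie_def, Matrix.sub_apply, Matrix.mul_apply]
    rw [Finset.sum_eq_zero (fun j _ => by rw [hY j, mul_zero]),
      Finset.sum_eq_zero (fun j _ => by rw [hX j, mul_zero]), sub_zero]

/-- `𝔭' = 𝔭 ∩ 𝔤'`, as a subalgebra of `𝔤'`. -/
def parG' (p n : ℕ) : LieSubalgebra ℂ (soG' p n) :=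
  (parG p n).comap (soG' p n).incl

theorem lie_zero_zero {p n : ℕ} {X Y : soG p n} (hX : X ∈ parG p n) (hY : Y ∈ parG p n) :
    (⁅X, Y⁆ : soG p n).1 0 0 = 0 := by
  simp only [LieSubalgebra.coe_bracket, Ring.lie_def, Matrix.sub_apply, Matrix.mul_apply]
  rw [Finset.sum_eq_single 0 (fun j _ hj => by rw [hY j hj, mul_zero]) (by simp),
    Finset.sum_eq_single 0 (fun j _ hj => by rw [hX j hj, mul_zero]) (by simp), mul_comm, sub_self]

/-- The one-dimensional representation `ℂ_lam` of `𝔭`: `X` acts on `ℂ` by the scalar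
`lam * X₀₀`. -/
def charG (p n : ℕ) (lam : ℂ) : parG p n →ₗ⁅ℂ⁆ Module.End ℂ ℂ where
  toFun X := (lam * X.1.1 0 0) • LinearMap.id
  map_add' X Y := by simp [mul_add, add_smul]
  map_smul' c X := by simp [smul_smul]; ring_nf
  map_lie' {X Y} := by
    have h := lie_zero_zero X.2 Y.2
    rw [← LieSubalgebra.coe_bracket] at h
    rw [h]
    ext
    simp [Ring.lie_def, mul_comm, mul_left_comm]

/-- The one-dimensional representation `ℂ_lam` of `𝔭'`: the restriction of the one of `𝔭`. -/
def charG' (p n : ℕ) (lam : ℂ) : parG' p n →ₗ⁅ℂ⁆ Module.End ℂ ℂ where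
  toFun X := (lam * X.1.1.1 0 0) • LinearMap.id
  map_add' X Y := by simp [mul_add, add_smul]
  map_smul' c X := by simp [smul_smul]; ring_nf
  map_lie' {X Y} := by
    have h := lie_zero_zero (X := X.1.1) (Y := Y.1.1) X.2 Y.2
    rw [← LieSubalgebra.coe_bracket, ← LieSubalgebra.coe_bracket] at h
    rw [h]
    ext
    simp [Ring.lie_def, mul_comm, mul_left_comm]

/-- `M_𝔭^𝔤(lam) = U(𝔤) ⊗_{U(𝔭)} ℂ_lam`. It is a module over `𝔤`, and over `𝔤'` by restriction. -/
abbrev VermaG (p n : ℕ) (lam : ℂ) : Type := GenVerma (parG p n) (charG p n lam)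

/-- `M_{𝔭'}^{𝔤'}(lam) = U(𝔤') ⊗_{U(𝔭')} ℂ_lam`. -/
abbrev VermaG' (p n : ℕ) (lam : ℂ) : Type := GenVerma (parG' p n) (charG' p n lam)

/-- `λ_j = (-n + 1 + j) / 2`. -/
def excParam (n j : ℕ) : ℂ := (-(n : ℂ) + 1 + j) / 2

end Conformal

/-- `0 → A → B → C → 0`, with maps `f` and `g`, is a non-split short exact sequence of modules
over the Lie algebra `L`. -/
structure IsNonSplitExact {L A B C : Type*} [LieRing L] [LieAlgebra ℂ L]
    [AddCommGroup A] [Module ℂ A] [LieRingModule L A] [LieModule ℂ L A]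
    [AddCommGroup B] [Module ℂ B] [LieRingModule L B] [LieModule ℂ L B]
    [AddCommGroup C] [Module ℂ C] [LieRingModule L C] [LieModule ℂ L C]
    (f : A →ₗ⁅ℂ, L⁆ B) (g : B →ₗ⁅ℂ, L⁆ C) : Prop where
  injective : Function.Injective f
  surjective : Function.Surjective g
  exact : Function.Exact f g
  not_split : ¬ ∃ s : C →ₗ⁅ℂ, L⁆ B, ∀ c, g (s c) = c

end

/-! ### Universal property and freeness of scalar generalized Verma modules -/

/-! The module M_𝔭^𝔤(λ) is modelled on ℂ[y_1, …, y_n]: Y_i acts by multiplication, the Levi part by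
first order operators, the nilradical of 𝔭 by the second order operators `raise`. `act_lie` checks
that this is a representation. `GenVerma.exists_equiv` identifies it with the induced module without
PBW: monomials in the Y_i span the induced module, and their images in the model are already
independent.

Put d = n - 1, t = y_n and s = `quad p d`. Since Y_1, …, Y_d lie in 𝔤', the restriction is studied
over ℂ[y_1, …, y_d], where any family of leading polynomials F_N = ∑ c_m s^m t^(N-2m), c_0 = 1, one
for each degree N, is a basis (`leadingBasis`). Such an F_N has weight λ - N, and generates a copy
of M_𝔭'^𝔤'(λ - N) as soon as the operators `raise` with index j < d kill it. By
`RotInv.quad_mul_raise`, s · raise_j = ε_j y_j · `singOp` on these polynomials, and `singOp` = 0 is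
a two-term recursion for c_m with diagonal coefficient m (2m + d + 2λ - 2N), 1 ≤ m ≤ N/2.

At λ = λ_j one has 2λ = j - d, so the critical factor is 2m + j - 2N. For odd j it never vanishes:
every degree carries a singular vector, which is (1). For j = 2k it vanishes at m = N - k, which is
in range exactly when k < N ≤ 2k. Write such an N as 2k - a and put l = k - a. Then
`exists_singular_pair` gives G of degree N with `singOp` G = κ s^l F, where κ ≠ 0 and F is the
singular vector of degree a. The span of F and G over ℂ[y_1, …, y_d] is M_{a,2k-a}: F generates the
submodule and G the quotient.

A splitting would produce a singular vector G + rF with r ∈ ℂ[y_1, …, y_d] homogeneous of degree 2l.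
But `singOp_rename_mul` shows that `singOp` kills rF at resonance, so `singOp` (G + rF) = κ s^l F ≠
0, a contradiction. -/

theorem exists_algHom_of_commute {A ι : Type*} [Ring A] [Algebra ℂ A] (a : ι → A)
    (ha : ∀ i j, a i * a j = a j * a i) :
    ∃ φ : MvPolynomial ι ℂ →ₐ[ℂ] A, ∀ i, φ (MvPolynomial.X i) = a i := by
  -- `A` is not commutative, but the subalgebra generated by the `a i` is, and polynomials can be
  -- evaluated there.
  have := Algebra.isMulCommutative_adjoin ℂ (s := Set.range a)
    (by rintro _ ⟨i, rfl⟩ _ ⟨j, rfl⟩; exact ha i j)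
  let : CommRing (Algebra.adjoin ℂ (Set.range a)) :=
    { (Algebra.adjoin ℂ (Set.range a)).toRing with
      mul_comm := IsMulCommutative.is_comm.comm }
  refine ⟨(Algebra.adjoin ℂ (Set.range a)).val.comp
    (MvPolynomial.aeval fun i => ⟨a i, Algebra.subset_adjoin ⟨i, rfl⟩⟩), fun i => ?_⟩
  simp

/-- The inclusion of the generated subalgebra has a section by the universal property: the composite
fixes every `ι x`, hence is the identity. -/
theorem UniversalEnvelopingAlgebra.adjoin_range_ι {L : Type*} [LieRing L] [LieAlgebra ℂ L] :
    Algebra.adjoin ℂ (Set.range (ι ℂ (L := L))) = ⊤ := by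
  let B := Algebra.adjoin ℂ (Set.range (ι ℂ (L := L)))
  let f : L →ₗ⁅ℂ⁆ B :=
    { toFun := fun x => ⟨ι ℂ x, Algebra.subset_adjoin ⟨x, rfl⟩⟩
      map_add' := fun x y => by ext; simp
      map_smul' := fun c x => by ext; simp
      map_lie' := fun {x y} => by
        apply Subtype.ext
        simp [LieRing.of_associative_ring_bracket] }
  have h : B.val.comp (lift ℂ f) = AlgHom.id ℂ _ := by
    apply hom_ext
    ext x
    change ((lift ℂ f (ι ℂ x) : B) : UniversalEnvelopingAlgebra ℂ L) = ι ℂ x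
    rw [lift_ι_apply]
    rfl
  refine eq_top_iff.mpr fun u _ => ?_
  have := DFunLike.congr_fun h u
  change ((lift ℂ f u : B) : UniversalEnvelopingAlgebra ℂ L) = u at this
  rw [← this]
  exact (lift ℂ f u).2

namespace GenVerma

variable {L : Type*} [LieRing L] [LieAlgebra ℂ L] {P : LieSubalgebra ℂ L}
  {ρ : P →ₗ⁅ℂ⁆ Module.End ℂ ℂ}

variable (P ρ) in
/-- The canonical generator `1 ⊗ 1`. -/
noncomputable def gen : GenVerma P ρ :=
  (balanced P ρ).mkQ (1 ⊗ₜ[ℂ] 1)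

theorem mkQ_tmul (u : UniversalEnvelopingAlgebra ℂ L) (z : ℂ) :
    ((balanced P ρ).mkQ (u ⊗ₜ[ℂ] z) : GenVerma P ρ) = z • (u • gen P ρ) := by
  have h : u ⊗ₜ[ℂ] z = (algebraMap ℂ (UniversalEnvelopingAlgebra ℂ L) z * u) • ((1 : UniversalEnvelopingAlgebra ℂ L) ⊗ₜ[ℂ] (1 : ℂ)) := by
    rw [TensorProduct.smul_tmul', ← Algebra.smul_def, smul_eq_mul, mul_one, TensorProduct.smul_tmul,
      smul_eq_mul, mul_one]
  rw [h, map_smul, mul_smul, algebraMap_smul]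
  rfl

theorem lie_gen (X : P) : ⁅(X : L), gen P ρ⁆ = ρ X 1 • gen P ρ := by
  have h1 : ⁅(X : L), gen P ρ⁆ =
      ((balanced P ρ).mkQ (UniversalEnvelopingAlgebra.ι ℂ (X : L) ⊗ₜ[ℂ] 1) : GenVerma P ρ) := by
    rw [mkQ_tmul, one_smul]; rfl
  have h2 : ρ X 1 • gen P ρ = ((balanced P ρ).mkQ (1 ⊗ₜ[ℂ] ρ X 1) : GenVerma P ρ) := by
    rw [mkQ_tmul, one_smul]
  rw [h1, h2]
  refine (Submodule.Quotient.eq _).mpr (Submodule.subset_span ⟨1, X, 1, ?_⟩)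
  rw [one_mul]

theorem mem_of_lie_mem (S : Submodule ℂ (GenVerma P ρ)) (h0 : gen P ρ ∈ S)
    (h : ∀ (x : L), ∀ m ∈ S, ⁅x, m⁆ ∈ S) (m : GenVerma P ρ) : m ∈ S := by
  have hu : ∀ u : UniversalEnvelopingAlgebra ℂ L, ∀ m ∈ S, u • m ∈ S := by
    intro u
    have : u ∈ Algebra.adjoin ℂ (Set.range (UniversalEnvelopingAlgebra.ι ℂ (L := L))) := by
      rw [UniversalEnvelopingAlgebra.adjoin_range_ι]; trivial
    induction this using Algebra.adjoin_induction with
    | mem x hx => obtain ⟨x, rfl⟩ := hx; exact h x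
    | algebraMap r => intro m hm; rw [algebraMap_smul]; exact S.smul_mem r hm
    | add x y _ _ hx hy => intro m hm; rw [add_smul]; exact S.add_mem (hx m hm) (hy m hm)
    | mul x y _ _ hx hy => intro m hm; rw [mul_smul]; exact hx _ (hy m hm)
  obtain ⟨t, rfl⟩ := (balanced P ρ).mkQ_surjective m
  induction t using TensorProduct.induction_on with
  | zero => rw [map_zero]; exact S.zero_mem
  | tmul u z => exact mkQ_tmul (P := P) (ρ := ρ) u z ▸ S.smul_mem z (hu u _ h0)
  | add x y hx hy => rw [map_add]; exact S.add_mem hx hy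

section lift

variable {N : Type*} [AddCommGroup N] [Module ℂ N] [LieRingModule L N] [LieModule ℂ L N]

/-- Frobenius reciprocity: a `P`-eigenvector of the right character is the image of the canonical
generator. The map `u ⊗ z ↦ z u v` respects the balancing relations exactly because of `hv`. -/
theorem exists_lift (v : N) (hv : ∀ X : P, ⁅(X : L), v⁆ = ρ X 1 • v) :
    ∃ φ : GenVerma P ρ →ₗ⁅ℂ, L⁆ N, φ (gen P ρ) = v := by
  let A := UniversalEnvelopingAlgebra.lift ℂ (LieModule.toEnd ℂ L N)
  have hA : ∀ x n, A (UniversalEnvelopingAlgebra.ι ℂ x) n = ⁅x, n⁆ := by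
    intro x n
    rw [UniversalEnvelopingAlgebra.lift_ι_apply]; rfl
  let B : UniversalEnvelopingAlgebra ℂ L ⊗[ℂ] ℂ →ₗ[ℂ] N :=
    ((LinearMap.applyₗ v).comp A.toLinearMap).comp
      (TensorProduct.rid ℂ (UniversalEnvelopingAlgebra ℂ L)).toLinearMap
  have hB : ∀ u z, B (u ⊗ₜ z) = z • A u v := by intro u z; simp [B]
  have hBs : ∀ u t, B (u • t) = A u (B t) := by
    intro u t
    induction t using TensorProduct.induction_on with
    | zero => simp
    | tmul w z => rw [TensorProduct.smul_tmul', hB, hB, smul_eq_mul, map_mul, map_smul]; rfl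
    | add x y hx hy => rw [smul_add, map_add, hx, hy, map_add, map_add]
  have hker : ∀ t ∈ balanced P ρ, B t = 0 := by
    intro t ht
    induction ht using Submodule.span_induction with
    | mem t ht =>
      obtain ⟨u, X, z, rfl⟩ := ht
      rw [map_sub, hB, hB, map_mul, Module.End.mul_apply, hA, hv, map_smul, smul_smul, ← sub_smul]
      have : ρ X z = z * ρ X 1 := by
        rw [← smul_eq_mul, ← map_smul, smul_eq_mul, mul_one]
      rw [this, sub_self, zero_smul]
    | zero => simp
    | add x y _ _ hx hy => rw [map_add, hx, hy, add_zero]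
    | smul u x _ hx => rw [hBs, hx, map_zero]
  let φ : GenVerma P ρ →ₗ[ℂ] N :=
    Submodule.liftQ ((balanced P ρ).restrictScalars ℂ) B (fun t ht => LinearMap.mem_ker.mpr (hker t ht))
  have hφ : ∀ t, φ ((balanced P ρ).mkQ t) = B t := fun t => rfl
  refine ⟨{ φ with map_lie' := ?_ }, ?_⟩
  · intro x m
    obtain ⟨t, rfl⟩ := (balanced P ρ).mkQ_surjective m
    change φ ((balanced P ρ).mkQ (UniversalEnvelopingAlgebra.ι ℂ x • t)) = _
    rw [hφ, hBs, hA]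
    rfl
  · change B (1 ⊗ₜ 1) = v
    rw [hB, map_one, one_smul]; rfl

end lift

end GenVerma

/-- If `[x, T 1] ∈ S` for all `x`, where `T : ℂ[y] → V` intertwines multiplication by `yᵢ` with a
linear system `Y i` of elements of `L` and `S` is stable under the `Y i`, then
`[x, T f] ∈ S` for all `x` and `f`. -/
theorem lie_mem_of_intertwine {L V ι : Type*} [LieRing L] [LieAlgebra ℂ L] [AddCommGroup V]
    [Module ℂ V] [LieRingModule L V] [LieModule ℂ L V] (Y : ι → L) (S : Submodule ℂ V)
    (hS : ∀ i, ∀ m ∈ S, ⁅Y i, m⁆ ∈ S) (T : MvPolynomial ι ℂ →ₗ[ℂ] V)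
    (hT : ∀ i f, T (MvPolynomial.X i * f) = ⁅Y i, T f⁆) (h1 : ∀ x : L, ⁅x, T 1⁆ ∈ S)
    (f : MvPolynomial ι ℂ) (x : L) : ⁅x, T f⁆ ∈ S := by
  induction f using MvPolynomial.induction_on generalizing x with
  | C a =>
    rw [show (MvPolynomial.C a : MvPolynomial ι ℂ) = a • 1 by
      rw [MvPolynomial.smul_eq_C_mul, mul_one], map_smul, lie_smul]
    exact S.smul_mem _ (h1 x)
  | add p q hp hq => rw [map_add, lie_add]; exact S.add_mem (hp x) (hq x)
  | mul_X p i hp =>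
    -- `[x, Y_i m] = [[x, Y_i], m] + [Y_i, [x, m]]`; the first term is why the induction runs over
    -- all `x` at once.
    rw [mul_comm, hT, leibniz_lie]
    exact S.add_mem (hp _) (hS i _ (hp x))

namespace GenVerma

variable {L ι : Type*} [LieRing L] [LieAlgebra ℂ L] {P : LieSubalgebra ℂ L}
  {ρ : P →ₗ⁅ℂ⁆ Module.End ℂ ℂ}

/-- If `L = ∑ ℂ Yᵢ + P` with commuting `Yᵢ`, then the generalized Verma module is spanned by the
monomials in the `Yᵢ` applied to the generator. -/
theorem exists_poly_surjective (Y : ι → L) (hY : ∀ i j, ⁅Y i, Y j⁆ = 0)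
    (hspan : ∀ x : L, ∃ y ∈ Submodule.span ℂ (Set.range Y), x - y ∈ P) :
    ∃ T : MvPolynomial ι ℂ →ₗ[ℂ] GenVerma P ρ, T 1 = gen P ρ ∧
      (∀ i f, T (MvPolynomial.X i * f) = ⁅Y i, T f⁆) ∧ Function.Surjective T := by
  obtain ⟨φ, hφ⟩ := exists_algHom_of_commute
    (fun i => UniversalEnvelopingAlgebra.ι ℂ (Y i)) (fun i j => by
      rw [← sub_eq_zero, ← ι_lie, hY, map_zero])
  let T : MvPolynomial ι ℂ →ₗ[ℂ] GenVerma P ρ :=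
    { toFun := fun f => φ f • gen P ρ
      map_add' := fun f g => by rw [map_add, add_smul]
      map_smul' := fun c f => by rw [map_smul, smul_assoc]; rfl }
  have hT1 : T 1 = gen P ρ := by
    change φ 1 • gen P ρ = _
    rw [map_one, one_smul]
  have hTX : ∀ i f, T (MvPolynomial.X i * f) = ⁅Y i, T f⁆ := by
    intro i f
    change φ (MvPolynomial.X i * f) • gen P ρ = _
    rw [map_mul, mul_smul, hφ]; rfl
  refine ⟨T, hT1, hTX, fun m => ?_⟩
  have hS : ∀ i, ∀ m ∈ LinearMap.range T, ⁅Y i, m⁆ ∈ LinearMap.range T := by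
    rintro i _ ⟨f, rfl⟩
    exact ⟨_, hTX i f⟩
  -- The range contains the generator, so it suffices that it is stable under `L`; this reduces to
  -- the action on the generator, where `L = ∑ ℂ Y_i + P` is used.
  refine mem_of_lie_mem (LinearMap.range T) ⟨1, hT1⟩ ?_ m
  rintro x _ ⟨f, rfl⟩
  refine lie_mem_of_intertwine Y _ hS T hTX (fun x => ?_) f x
  obtain ⟨y, hy, hxy⟩ := hspan x
  rw [← sub_add_cancel x y, add_lie, hT1, lie_gen (ρ := ρ) ⟨x - y, hxy⟩]
  refine Submodule.add_mem _ (Submodule.smul_mem _ _ ⟨1, hT1⟩) ?_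
  clear hxy
  induction hy using Submodule.span_induction with
  | mem z hz => obtain ⟨i, rfl⟩ := hz; exact hS i _ ⟨1, hT1⟩
  | zero => rw [zero_lie]; exact Submodule.zero_mem _
  | add a b _ _ ha hb => rw [add_lie]; exact Submodule.add_mem _ ha hb
  | smul c a _ ha => rw [smul_lie]; exact Submodule.smul_mem _ _ ha

/-- Recognition of a generalized Verma module as a free module over `ℂ[Y]` on an eigenvector
of `P`. -/
theorem exists_equiv {N : Type*} [AddCommGroup N] [Module ℂ N] [LieRingModule L N] [LieModule ℂ L N]
    (Y : ι → L) (hY : ∀ i j, ⁅Y i, Y j⁆ = 0)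
    (hspan : ∀ x : L, ∃ y ∈ Submodule.span ℂ (Set.range Y), x - y ∈ P)
    (ψ : MvPolynomial ι ℂ →ₗ[ℂ] N) (hψ : ∀ i f, ψ (MvPolynomial.X i * f) = ⁅Y i, ψ f⁆)
    (hv : ∀ X : P, ⁅(X : L), ψ 1⁆ = ρ X 1 • ψ 1) (hbij : Function.Bijective ψ) :
    ∃ e : GenVerma P ρ ≃ₗ⁅ℂ, L⁆ N, e (gen P ρ) = ψ 1 := by
  obtain ⟨φ, hφ⟩ := exists_lift (ψ 1) hv
  obtain ⟨T, hT1, hTX, hTs⟩ := exists_poly_surjective (P := P) (ρ := ρ) Y hY hspan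
  -- With `T` surjective and `φ ∘ T = ψ` bijective, `φ` must be bijective; this is where PBW is
  -- bypassed.
  have key : ∀ f, φ (T f) = ψ f := by
    intro f
    induction f using MvPolynomial.induction_on with
    | C a =>
      rw [show (MvPolynomial.C a : MvPolynomial ι ℂ) = a • 1 by
        rw [MvPolynomial.smul_eq_C_mul, mul_one], map_smul, map_smul, map_smul, hT1, hφ]
    | add p q hp hq => rw [map_add, map_add, map_add, hp, hq]
    | mul_X p i hp => rw [mul_comm, hTX, LieModuleHom.map_lie, hp, hψ]
  have hb : Function.Bijective φ := by
    constructor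
    · intro a b hab
      obtain ⟨f, rfl⟩ := hTs a
      obtain ⟨g, rfl⟩ := hTs b
      rw [key, key] at hab
      rw [hbij.1 hab]
    · intro n
      obtain ⟨f, rfl⟩ := hbij.2 n
      exact ⟨T f, key f⟩
  exact ⟨{ φ with
    invFun := (Equiv.ofBijective φ hb).symm
    left_inv := (Equiv.ofBijective φ hb).left_inv
    right_inv := (Equiv.ofBijective φ hb).right_inv }, hφ⟩

end GenVerma

/-! ### The matrices in `𝔤` -/

namespace Conformal

variable {p n : ℕ}

/-- The sign `ε` of the coordinate `i + 1`, for `i < n`. -/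
def eps (p : ℕ) {n : ℕ} (i : Fin n) : ℂ := if (i : ℕ) + 1 < p then 1 else -1

/-- The position of the coordinate `i + 1`, for `i < n`, among `0, …, n + 1`. -/
def mid {n : ℕ} (i : Fin n) : Fin (n + 2) := i.succ.castSucc

theorem eps_mul_self (i : Fin n) : eps p i * eps p i = 1 := by
  unfold eps; split_ifs <;> norm_num

theorem eps_ne_zero (i : Fin n) : eps p i ≠ 0 := by
  unfold eps; split_ifs <;> norm_num

theorem mid_ne_zero (i : Fin n) : mid i ≠ 0 := by
  simp [mid, Fin.ext_iff]

theorem mid_ne_last (i : Fin n) : mid i ≠ Fin.last (n + 1) := by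
  have := i.2
  simp only [mid, ne_eq, Fin.ext_iff, Fin.val_castSucc, Fin.val_succ, Fin.val_last]; omega

theorem mid_injective : Function.Injective (mid (n := n)) := by
  intro i j h
  simpa [mid] using h

@[simp]
theorem mid_inj {i j : Fin n} : mid i = mid j ↔ i = j := mid_injective.eq_iff

theorem sum_fin_add_two {M : Type*} [AddCommMonoid M] (f : Fin (n + 2) → M) :
    ∑ i, f i = f 0 + ∑ i : Fin n, f (mid i) + f (Fin.last (n + 1)) := by
  rw [Fin.sum_univ_castSucc, Fin.sum_univ_succ]
  rfl

theorem fin_add_two_cases {motive : Fin (n + 2) → Prop} (h0 : motive 0) (hm : ∀ i : Fin n, motive (mid i))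
    (hl : motive (Fin.last (n + 1))) (i : Fin (n + 2)) : motive i := by
  induction i using Fin.lastCases with
  | last => exact hl
  | cast i =>
    induction i using Fin.cases with
    | zero => exact h0
    | succ i => exact hm i

theorem gram_zero (j : Fin (n + 2)) : gram p n 0 j = if j = Fin.last (n + 1) then 1 else 0 := by
  unfold gram
  have : (0 : Fin (n + 2)) ≠ Fin.last (n + 1) := by simp [Fin.ext_iff]
  by_cases h : j = Fin.last (n + 1) <;> simp [h, this]

theorem gram_last (j : Fin (n + 2)) : gram p n (Fin.last (n + 1)) j = if j = 0 then 1 else 0 := by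
  unfold gram
  have : (Fin.last (n + 1)) ≠ 0 := by simp [Fin.ext_iff]
  by_cases h : j = 0 <;> simp [h, this]

theorem gram_mid (i : Fin n) (j : Fin (n + 2)) :
    gram p n (mid i) j = if j = mid i then eps p i else 0 := by
  unfold gram
  have h0 := mid_ne_zero i
  have h1 := mid_ne_last i
  rw [if_neg (by tauto)]
  by_cases h : j = mid i
  · subst h
    simp only [true_and, if_true]
    rw [if_pos ⟨h0, h1⟩]
    rfl
  · rw [if_neg (by tauto), if_neg h]

theorem gram_symm (i j : Fin (n + 2)) : gram p n i j = gram p n j i := by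
  by_cases hij : i = j
  · rw [hij]
  · simp [gram, hij, Ne.symm hij, and_comm, or_comm]

theorem gram_mul_zero (X : Matrix (Fin (n + 2)) (Fin (n + 2)) ℂ) (j) :
    (gram p n * X) 0 j = X (Fin.last (n + 1)) j := by
  simp [Matrix.mul_apply, gram_zero]

theorem gram_mul_last (X : Matrix (Fin (n + 2)) (Fin (n + 2)) ℂ) (j) :
    (gram p n * X) (Fin.last (n + 1)) j = X 0 j := by
  simp [Matrix.mul_apply, gram_last]

theorem gram_mul_mid (X : Matrix (Fin (n + 2)) (Fin (n + 2)) ℂ) (i : Fin n) (j) :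
    (gram p n * X) (mid i) j = eps p i * X (mid i) j := by
  simp [Matrix.mul_apply, gram_mid]

/-- The condition says that `J X` is antisymmetric. As `J` only swaps the two extreme rows and
scales the others by signs, all relations between entries of `X` can be read off from it. -/
theorem mem_soG_iff (X : Matrix (Fin (n + 2)) (Fin (n + 2)) ℂ) :
    X ∈ soG p n ↔ ∀ i j, (gram p n * X) i j + (gram p n * X) j i = 0 := by
  rw [mem_skewAdjointMatricesLieSubalgebra, mem_skewAdjointMatricesSubmodule]
  unfold Matrix.IsSkewAdjoint Matrix.IsAdjointPair
  rw [← Matrix.ext_iff]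
  have h : ∀ i j, (X.transpose * gram p n) i j = (gram p n * X) j i := by
    intro i j
    simp only [Matrix.mul_apply, Matrix.transpose_apply]
    exact Finset.sum_congr rfl fun k _ => by rw [gram_symm, mul_comm]
  refine forall₂_congr fun i j => ?_
  rw [h, mul_neg, Matrix.neg_apply]
  exact eq_neg_iff_add_eq_zero.trans (by rw [add_comm])

theorem soG_apply_last_zero (X : soG p n) : X.1 (Fin.last (n + 1)) 0 = 0 := by
  have := (mem_soG_iff X.1).mp X.2 0 0
  rw [gram_mul_zero] at this
  linear_combination this / 2

theorem soG_apply_zero_last (X : soG p n) : X.1 0 (Fin.last (n + 1)) = 0 := by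
  have := (mem_soG_iff X.1).mp X.2 (Fin.last _) (Fin.last _)
  rw [gram_mul_last] at this
  linear_combination this / 2

theorem soG_apply_mid_last (X : soG p n) (r : Fin n) :
    X.1 (mid r) (Fin.last (n + 1)) = - eps p r * X.1 0 (mid r) := by
  have := (mem_soG_iff X.1).mp X.2 (Fin.last _) (mid r)
  rw [gram_mul_last, gram_mul_mid] at this
  linear_combination eps p r * this - X.1 (mid r) (Fin.last (n + 1)) * eps_mul_self (p := p) r

theorem soG_apply_mid_mid (X : soG p n) (r c : Fin n) :
    eps p r * X.1 (mid r) (mid c) + eps p c * X.1 (mid c) (mid r) = 0 := by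
  have := (mem_soG_iff X.1).mp X.2 (mid r) (mid c)
  rwa [gram_mul_mid, gram_mul_mid] at this

/-- The matrix of the basis vector `Y_i` of the opposite nilradical of `𝔭`. -/
def lowerMat (p : ℕ) {n : ℕ} (i : Fin n) : Matrix (Fin (n + 2)) (Fin (n + 2)) ℂ :=
  Matrix.single (mid i) 0 1 - Matrix.single (Fin.last (n + 1)) (mid i) (eps p i)

/-- The basis vector `Y_i` of the opposite nilradical of `𝔭`. -/
def lower (p : ℕ) {n : ℕ} (i : Fin n) : soG p n :=
  ⟨lowerMat p i, by
    rw [mem_soG_iff]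
    have key : gram p n * lowerMat p i =
        eps p i • (Matrix.single (mid i) 0 1 - Matrix.single 0 (mid i) 1) := by
      ext a b
      have h0 := mid_ne_zero i
      have h1 := mid_ne_last i
      have h2 : (0 : Fin (n + 2)) ≠ Fin.last (n + 1) := by simp [Fin.ext_iff]
      induction a using fin_add_two_cases with
      | h0 =>
        rw [gram_mul_zero]
        simp [lowerMat, Matrix.single_apply, h0, h1]
      | hm r =>
        rw [gram_mul_mid]
        have h3 := (mid_ne_zero r).symm
        have h4 := (mid_ne_last r).symm
        by_cases hr : i = r
        · subst hr; simp [lowerMat, Matrix.single_apply, h3, h4]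
        · simp [lowerMat, h3, h4, hr]
      | hl =>
        rw [gram_mul_last]
        simp [lowerMat, h0, h1, h2, h2.symm]
    intro a b
    rw [key]
    simp only [Matrix.smul_apply, Matrix.sub_apply, Matrix.single_apply, smul_eq_mul, and_comm]
    ring⟩

theorem lower_val (i : Fin n) : (lower p i).1 =
  Matrix.single (mid i) 0 1 - Matrix.single (Fin.last (n + 1)) (mid i) (eps p i) := rfl

theorem lower_apply_mid_zero (i r : Fin n) : (lower p i).1 (mid r) 0 = if i = r then 1 else 0 := by
  have h4 := (mid_ne_last r).symm
  simp [lower_val, Matrix.single_apply, h4]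

theorem lower_apply_zero (i : Fin n) (c) : (lower p i).1 0 c = 0 := by
  have h3 := (mid_ne_zero i)
  have h2 : Fin.last (n + 1) ≠ 0 := by simp [Fin.ext_iff]
  simp [lower_val, h3, h2]

theorem lower_apply_mid_mid (i r c : Fin n) : (lower p i).1 (mid r) (mid c) = 0 := by
  have h3 := (mid_ne_zero c).symm
  have h2 := (mid_ne_last r).symm
  simp [lower_val, h3, h2]

theorem lie_lower_val (X : soG p n) (i : Fin n) (a b : Fin (n + 2)) :
    (⁅X, lower p i⁆ : soG p n).1 a b =
      (if b = 0 then X.1 a (mid i) else 0) -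
      (if b = mid i then X.1 a (Fin.last _) * eps p i else 0) -
      (if a = mid i then X.1 0 b else 0) + (if a = Fin.last _ then eps p i * X.1 (mid i) b else 0) := by
  rw [LieSubalgebra.coe_bracket, Ring.lie_def, Matrix.sub_apply, lower_val, mul_sub, sub_mul,
    Matrix.sub_apply, Matrix.sub_apply]
  have h1 : ∀ (r c : Fin (n + 2)) (z : ℂ),
      (X.1 * Matrix.single r c z) a b = if b = c then X.1 a r * z else 0 := by
    intro r c z
    split_ifs with h
    · subst h; simp
    · rw [Matrix.mul_single_apply_of_ne _ _ _ _ _ h]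
  have h2 : ∀ (r c : Fin (n + 2)) (z : ℂ),
      (Matrix.single r c z * X.1) a b = if a = r then z * X.1 c b else 0 := by
    intro r c z
    split_ifs with h
    · subst h; simp
    · rw [Matrix.single_mul_apply_of_ne _ _ _ _ _ h]
  rw [h1, h1, h2, h2]
  simp only [mul_one, one_mul]
  ring

/-- This and the next three lemmas compute the only entries of `[X, Y_i]` on which the operator
`act` depends. -/
theorem lie_lower_mid_zero (X : soG p n) (i r : Fin n) :
    (⁅X, lower p i⁆ : soG p n).1 (mid r) 0 = X.1 (mid r) (mid i) - if r = i then X.1 0 0 else 0 := by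
  rw [lie_lower_val, if_pos rfl, if_neg (mid_ne_zero i).symm, if_neg (mid_ne_last r)]
  simp

theorem lie_lower_zero_zero (X : soG p n) (i : Fin n) :
    (⁅X, lower p i⁆ : soG p n).1 0 0 = X.1 0 (mid i) := by
  have h2 : (0 : Fin (n + 2)) ≠ Fin.last (n + 1) := by simp [Fin.ext_iff]
  rw [lie_lower_val, if_pos rfl, if_neg (mid_ne_zero i).symm, if_neg (mid_ne_zero i).symm,
    if_neg h2, sub_zero, sub_zero, add_zero]

theorem lie_lower_zero_mid (X : soG p n) (i r : Fin n) :
    (⁅X, lower p i⁆ : soG p n).1 0 (mid r) = 0 := by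
  have h2 : (0 : Fin (n + 2)) ≠ Fin.last (n + 1) := by simp [Fin.ext_iff]
  rw [lie_lower_val, if_neg (mid_ne_zero r), if_neg (mid_ne_zero i).symm, if_neg h2,
    soG_apply_zero_last]
  simp

theorem lie_lower_mid_mid (X : soG p n) (i r c : Fin n) :
    (⁅X, lower p i⁆ : soG p n).1 (mid r) (mid c) =
      (if c = i then eps p i * eps p r * X.1 0 (mid r) else 0) - if r = i then X.1 0 (mid c) else 0 := by
  rw [lie_lower_val, if_neg (mid_ne_zero c), if_neg (mid_ne_last r), soG_apply_mid_last]
  simp only [mid_inj]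
  split_ifs <;> ring

theorem lie_mid_zero (X X' : soG p n) (r : Fin n) : (⁅X, X'⁆ : soG p n).1 (mid r) 0 =
    X.1 (mid r) 0 * X'.1 0 0 + ∑ i, X.1 (mid r) (mid i) * X'.1 (mid i) 0 -
      (X'.1 (mid r) 0 * X.1 0 0 + ∑ i, X'.1 (mid r) (mid i) * X.1 (mid i) 0) := by
  rw [LieSubalgebra.coe_bracket, Ring.lie_def, Matrix.sub_apply, Matrix.mul_apply,
    Matrix.mul_apply, sum_fin_add_two, sum_fin_add_two, soG_apply_last_zero, soG_apply_last_zero]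
  ring

theorem lie_zero_zero_eq (X X' : soG p n) : (⁅X, X'⁆ : soG p n).1 0 0 =
    ∑ i, X.1 0 (mid i) * X'.1 (mid i) 0 - ∑ i, X'.1 0 (mid i) * X.1 (mid i) 0 := by
  rw [LieSubalgebra.coe_bracket, Ring.lie_def, Matrix.sub_apply, Matrix.mul_apply,
    Matrix.mul_apply, sum_fin_add_two, sum_fin_add_two, soG_apply_last_zero, soG_apply_last_zero]
  ring

theorem lie_lower_lower (i j : Fin n) : ⁅lower p i, lower p j⁆ = 0 := by
  apply Subtype.ext
  rw [LieSubalgebra.coe_bracket, Ring.lie_def, lower_val, lower_val]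
  have h0 : (0 : Fin (n + 2)) ≠ Fin.last (n + 1) := by simp [Fin.ext_iff]
  simp only [mul_sub, sub_mul]
  by_cases h : i = j
  · subst h; simp
  · have h' : mid i ≠ mid j := fun e => h (mid_injective e)
    simp [h0, mid_ne_last, h', h'.symm, (mid_ne_zero _).symm]

end Conformal

/-! ### The polynomial model of `M_𝔭^𝔤(lam)` -/

namespace Conformal

open MvPolynomial

variable {p n : ℕ}

/-- The Euler derivation. -/
noncomputable def euler (n : ℕ) : Derivation ℂ (MvPolynomial (Fin n) ℂ) (MvPolynomial (Fin n) ℂ) :=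
  mkDerivation ℂ X

/-- The Laplacian `∑ εᵢ ∂ᵢ²`. -/
noncomputable def lap (p n : ℕ) : MvPolynomial (Fin n) ℂ →ₗ[ℂ] MvPolynomial (Fin n) ℂ :=
  ∑ i, eps p i • ((pderiv i).toLinearMap ∘ₗ (pderiv i).toLinearMap)

theorem lap_apply (f : MvPolynomial (Fin n) ℂ) :
    lap p n f = ∑ i, C (eps p i) * pderiv i (pderiv i f) := by
  simp [lap, smul_eq_C_mul]

theorem derivation_sum_apply {ι R A M : Type*} [CommSemiring R] [CommSemiring A] [AddCommMonoid M]
    [Algebra R A] [Module A M] [Module R M] (s : Finset ι) (D : ι → Derivation R A M) (f : A) :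
    (∑ i ∈ s, D i) f = ∑ i ∈ s, D i f := by
  classical
  induction s using Finset.induction_on with
  | empty => simp
  | insert a s ha ih => rw [Finset.sum_insert ha, Finset.sum_insert ha, Derivation.add_apply, ih]

theorem lap_X_mul (i : Fin n) (f : MvPolynomial (Fin n) ℂ) :
    lap p n (X i * f) = X i * lap p n f + C (2 * eps p i) * pderiv i f := by
  have h : ∀ j, C (eps p j) * pderiv j (pderiv j (X i * f)) =
      X i * (C (eps p j) * pderiv j (pderiv j f)) +
        if j = i then C (2 * eps p i) * pderiv i f else 0 := by
    intro j
    by_cases hj : j = i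
    · subst hj
      simp only [Derivation.leibniz, smul_eq_mul, map_add, pderiv_X_self, map_mul, if_true]
      simp only [mul_one, Derivation.map_one_eq_zero, mul_zero, map_ofNat]
      ring
    · simp only [Derivation.leibniz, smul_eq_mul, pderiv_X_of_ne (Ne.symm hj), if_neg hj,
        mul_zero, add_zero]
      ring
  rw [lap_apply, lap_apply, Finset.sum_congr rfl fun j _ => h j, Finset.sum_add_distrib,
    ← Finset.mul_sum]
  simp

/-- The second order operator by which the basis vector of the nilradical of `𝔭` dual to `Y_j`
acts. -/
noncomputable def raise (p : ℕ) {n : ℕ} (lam : ℂ) (j : Fin n) :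
    MvPolynomial (Fin n) ℂ →ₗ[ℂ] MvPolynomial (Fin n) ℂ where
  toFun f := C (eps p j / 2) * (X j * lap p n f) - (euler n (pderiv j f) - C lam * pderiv j f)
  map_add' f g := by simp only [map_add]; ring
  map_smul' c f := by
    simp only [map_smul, Derivation.map_smul, RingHom.id_apply]
    simp only [smul_eq_C_mul]; ring

theorem raise_apply (lam : ℂ) (j : Fin n) (f : MvPolynomial (Fin n) ℂ) : raise p lam j f =
    C (eps p j / 2) * (X j * lap p n f) - (euler n (pderiv j f) - C lam * pderiv j f) := rfl

theorem euler_X (i : Fin n) : euler n (X i) = X i := mkDerivation_X _ _ _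

/-- The commutator of a second order raising operator with `y_i` is first order: a grading term plus
a rotation. It mirrors the bracket of the nilradical with its opposite, which lands in the Levi
part. -/
theorem raise_X_mul (lam : ℂ) (i j : Fin n) (f : MvPolynomial (Fin n) ℂ) :
    raise p lam j (X i * f) = X i * raise p lam j f +
      (if j = i then C lam * f - euler n f else 0) +
      C (eps p i * eps p j) * X j * pderiv i f - X i * pderiv j f := by
  have h2 : (C (eps p j / 2) * C (2 * eps p i) : MvPolynomial (Fin n) ℂ) =
      C (eps p i * eps p j) := by
    rw [← C_mul]; congr 1; ring
  rw [raise_apply, raise_apply, lap_X_mul, ← h2]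
  by_cases hj : j = i
  · subst hj
    simp only [Derivation.leibniz, smul_eq_mul, map_add, pderiv_X_self, if_true, euler_X, mul_one]
    ring
  · simp only [Derivation.leibniz, smul_eq_mul, pderiv_X_of_ne (Ne.symm hj), if_neg hj,
      euler_X, mul_zero, add_zero]
    ring

theorem raise_one (lam : ℂ) (j : Fin n) : raise p lam j 1 = 0 := by
  simp [raise_apply, lap_apply]

/-- The derivation by which the Levi part of a matrix acts. -/
noncomputable def leviDer (A : Matrix (Fin (n + 2)) (Fin (n + 2)) ℂ) :
    Derivation ℂ (MvPolynomial (Fin n) ℂ) (MvPolynomial (Fin n) ℂ) :=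
  mkDerivation ℂ fun c => ∑ r, C (A (mid r) (mid c)) * X r - C (A 0 0) * X c

theorem leviDer_X (A : Matrix (Fin (n + 2)) (Fin (n + 2)) ℂ) (c : Fin n) :
    leviDer A (X c) = ∑ r, C (A (mid r) (mid c)) * X r - C (A 0 0) * X c :=
  mkDerivation_X _ _ _

theorem leviDer_add (A B : Matrix (Fin (n + 2)) (Fin (n + 2)) ℂ) :
    leviDer (A + B) = leviDer A + leviDer B := by
  apply derivation_ext
  intro c
  simp only [Derivation.add_apply, leviDer_X, Matrix.add_apply, C_add, add_mul,
    Finset.sum_add_distrib]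
  ring

theorem leviDer_smul (z : ℂ) (A : Matrix (Fin (n + 2)) (Fin (n + 2)) ℂ) :
    leviDer (z • A) = z • leviDer A := by
  apply derivation_ext
  intro c
  simp only [Derivation.smul_apply, leviDer_X, Matrix.smul_apply, smul_eq_mul, C_mul,
    smul_eq_C_mul, mul_sub, Finset.mul_sum, mul_assoc]

/-- The action of a matrix in `𝔤` on polynomials. -/
noncomputable def act (p : ℕ) {n : ℕ} (lam : ℂ) (A : Matrix (Fin (n + 2)) (Fin (n + 2)) ℂ) :
    MvPolynomial (Fin n) ℂ →ₗ[ℂ] MvPolynomial (Fin n) ℂ :=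
  LinearMap.mulLeft ℂ (∑ i, C (A (mid i) 0) * X i + C (lam * A 0 0)) + (leviDer A).toLinearMap +
    ∑ j, A 0 (mid j) • raise p lam j

theorem act_apply (lam : ℂ) (A : Matrix (Fin (n + 2)) (Fin (n + 2)) ℂ)
    (f : MvPolynomial (Fin n) ℂ) : act p lam A f =
      (∑ i, C (A (mid i) 0) * X i + C (lam * A 0 0)) * f + leviDer A f +
        ∑ j, C (A 0 (mid j)) * raise p lam j f := by
  simp [act, smul_eq_C_mul]

theorem act_add (lam : ℂ) (A B : Matrix (Fin (n + 2)) (Fin (n + 2)) ℂ)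
    (f : MvPolynomial (Fin n) ℂ) : act p lam (A + B) f = act p lam A f + act p lam B f := by
  simp only [act_apply, leviDer_add, Derivation.add_apply, Matrix.add_apply, C_add, add_mul,
    mul_add, Finset.sum_add_distrib]
  ring

theorem act_smul (lam z : ℂ) (A : Matrix (Fin (n + 2)) (Fin (n + 2)) ℂ)
    (f : MvPolynomial (Fin n) ℂ) : act p lam (z • A) f = z • act p lam A f := by
  simp only [act_apply, leviDer_smul, Derivation.smul_apply, Matrix.smul_apply, smul_eq_mul,
    smul_eq_C_mul, mul_add, add_mul, Finset.mul_sum, Finset.sum_mul, C_mul, mul_assoc,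
    mul_left_comm (C lam) (C z)]

theorem act_lower (lam : ℂ) (i : Fin n) (f : MvPolynomial (Fin n) ℂ) :
    act p lam (lower p i).1 f = X i * f := by
  have hl : leviDer (lower p i).1 = 0 := by
    apply derivation_ext
    intro c
    simp [leviDer_X, lower_apply_mid_mid, lower_apply_zero]
  rw [act_apply, hl]
  simp [lower_apply_zero, lower_apply_mid_zero]

/-- Since `Y_i` acts as multiplication by `y_i`, this is the commutation relation of `A` with `Y_i`;
together with the action on `1` it determines the whole action. -/
theorem act_X_mul (lam : ℂ) (A : soG p n) (i : Fin n) (f : MvPolynomial (Fin n) ℂ) :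
    act p lam A.1 (X i * f) = X i * act p lam A.1 f + act p lam (⁅A, lower p i⁆ : soG p n).1 f := by
  -- Derivations agree once they agree on the variables. Only the row `A 0 (mid _)` survives, giving
  -- an infinitesimal rotation and a multiple of the Euler field.
  have hl : leviDer (⁅A, lower p i⁆ : soG p n).1 =
      (∑ r, C (eps p i * eps p r * A.1 0 (mid r)) * X r) •
        (pderiv i : Derivation ℂ (MvPolynomial (Fin n) ℂ) (MvPolynomial (Fin n) ℂ)) -
      (X i : MvPolynomial (Fin n) ℂ) • (∑ c, (C (A.1 0 (mid c)) : MvPolynomial (Fin n) ℂ) •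
        (pderiv c : Derivation ℂ (MvPolynomial (Fin n) ℂ) (MvPolynomial (Fin n) ℂ))) -
      (C (A.1 0 (mid i)) : MvPolynomial (Fin n) ℂ) • euler n := by
    apply derivation_ext
    intro c
    simp only [leviDer_X, lie_lower_zero_zero, lie_lower_mid_mid, Derivation.sub_apply,
      Derivation.smul_apply, smul_eq_mul, euler_X, derivation_sum_apply, pderiv_X,
      C_sub, sub_mul, Finset.sum_sub_distrib]
    simp only [Pi.single_apply]
    congr 2
    · by_cases h : c = i
      · subst h; simp
      · simp [h]
    · simp [apply_ite, mul_comm]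
  rw [act_apply, act_apply, act_apply, hl, lie_lower_zero_zero]
  simp only [lie_lower_zero_mid, lie_lower_mid_zero, C_0, zero_mul, Finset.sum_const_zero, add_zero,
    Derivation.leibniz, smul_eq_mul, raise_X_mul, Derivation.sub_apply, Derivation.smul_apply,
    derivation_sum_apply, leviDer_X]
  have h1 : ∑ j, C (A.1 0 (mid j)) * (X i * raise p lam j f +
      (if j = i then C lam * f - euler n f else 0) +
      C (eps p i * eps p j) * X j * pderiv i f - X i * pderiv j f) =
      X i * ∑ j, C (A.1 0 (mid j)) * raise p lam j f + C (A.1 0 (mid i)) * (C lam * f - euler n f) +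
      (∑ r, C (eps p i * eps p r * A.1 0 (mid r)) * X r) * pderiv i f -
      X i * ∑ j, C (A.1 0 (mid j)) * pderiv j f := by
    have e : ∀ j, C (A.1 0 (mid j)) * (X i * raise p lam j f +
        (if j = i then C lam * f - euler n f else 0) +
        C (eps p i * eps p j) * X j * pderiv i f - X i * pderiv j f) =
        X i * (C (A.1 0 (mid j)) * raise p lam j f) +
        (if j = i then C (A.1 0 (mid i)) * (C lam * f - euler n f) else 0) +
        C (eps p i * eps p j * A.1 0 (mid j)) * X j * pderiv i f -
        X i * (C (A.1 0 (mid j)) * pderiv j f) := by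
      intro j
      by_cases hj : j = i
      · subst hj
        simp only [if_true, C_mul]; ring
      · simp only [if_neg hj, C_mul]; ring
    rw [Finset.sum_congr rfl fun j _ => e j, Finset.sum_sub_distrib, Finset.sum_add_distrib,
      Finset.sum_add_distrib, ← Finset.mul_sum, ← Finset.mul_sum, ← Finset.sum_mul,
      Finset.sum_ite_eq' Finset.univ i, if_pos (Finset.mem_univ i)]
  have h2 : ∑ r, C (A.1 (mid r) (mid i) - if r = i then A.1 0 0 else 0) * X r =
      ∑ r, C (A.1 (mid r) (mid i)) * X r - C (A.1 0 0) * (X i : MvPolynomial (Fin n) ℂ) := by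
    simp only [C_sub, sub_mul, Finset.sum_sub_distrib]
    simp [apply_ite]
  rw [h1, h2]
  simp only [C_mul]
  ring

theorem act_one (lam : ℂ) (A : Matrix (Fin (n + 2)) (Fin (n + 2)) ℂ) :
    act p lam A 1 = ∑ i, C (A (mid i) 0) * X i + C (lam * A 0 0) := by
  simp [act_apply, raise_one]

/-- The base case of the representation property. On `1` the raising operators vanish, so `A · (B ·
1)` is explicit; its quadratic part is symmetric in `A`, `B` and cancels. -/
theorem act_act_one (lam : ℂ) (A B : soG p n) :
    act p lam (⁅A, B⁆ : soG p n).1 1 =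
      act p lam A.1 (act p lam B.1 1) - act p lam B.1 (act p lam A.1 1) := by
  have h : ∀ A B : soG p n, act p lam A.1 (act p lam B.1 1) =
      act p lam B.1 1 * act p lam A.1 1 + ∑ r, C (∑ i, A.1 (mid r) (mid i) * B.1 (mid i) 0) * X r -
        C (A.1 0 0) * ∑ i, C (B.1 (mid i) 0) * X i +
        C (lam * ∑ i, A.1 0 (mid i) * B.1 (mid i) 0) := by
    intro A B
    have h1 : ∀ i, act p lam A.1 (X i) = X i * act p lam A.1 1 +
        (∑ r, C (A.1 (mid r) (mid i)) * X r - C (A.1 0 0) * X i + C (lam * A.1 0 (mid i))) := by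
      intro i
      have := act_X_mul lam A i 1
      rw [mul_one] at this
      rw [this, act_one lam (⁅A, lower p i⁆ : soG p n).1, lie_lower_zero_zero]
      simp only [lie_lower_mid_zero, C_sub, sub_mul, Finset.sum_sub_distrib]
      simp [apply_ite]
    rw [act_one lam B.1, map_add]
    have h2 : ∀ z : ℂ, act p lam A.1 (C z) = C z * act p lam A.1 1 := by
      intro z
      rw [← smul_eq_C_mul, ← map_smul, smul_eq_C_mul, mul_one]
    have h3 : ∀ i, act p lam A.1 (C (B.1 (mid i) 0) * X i) =
        C (B.1 (mid i) 0) * X i * act p lam A.1 1 +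
          (∑ r, C (A.1 (mid r) (mid i)  * B.1 (mid i) 0) * X r -
          C (A.1 0 0) * (C (B.1 (mid i) 0) * X i) + C (lam * (A.1 0 (mid i) * B.1 (mid i) 0))) := by
      intro i
      rw [← smul_eq_C_mul, map_smul, smul_eq_C_mul, h1, smul_eq_C_mul]
      have : ∑ r, C (A.1 (mid r) (mid i)  * B.1 (mid i) 0) * X r =
          C (B.1 (mid i) 0) * ∑ r, C (A.1 (mid r) (mid i)) * (X r : MvPolynomial (Fin n) ℂ) := by
        rw [Finset.mul_sum]
        exact Finset.sum_congr rfl fun r _ => by rw [C_mul]; ring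
      rw [this]
      simp only [C_mul]; ring
    rw [map_sum, Finset.sum_congr rfl fun i _ => h3 i, h2]
    simp only [Finset.sum_add_distrib, Finset.sum_sub_distrib, ← Finset.sum_mul, ← Finset.mul_sum,
      map_sum, C_mul]
    rw [Finset.sum_comm]
    simp only [← Finset.sum_mul]
    ring
  rw [h A B, h B A, act_one lam (⁅A, B⁆ : soG p n).1, lie_zero_zero_eq]
  have h4 : ∑ i, C ((⁅A, B⁆ : soG p n).1 (mid i) 0) * X i =
      C (B.1 0 0) * ∑ i, C (A.1 (mid i) 0) * X i +
        ∑ r, C (∑ i, A.1 (mid r) (mid i) * B.1 (mid i) 0) * X r -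
      (C (A.1 0 0) * ∑ i, C (B.1 (mid i) 0) * X i +
        ∑ r, C (∑ i, B.1 (mid r) (mid i) * A.1 (mid i) 0) * (X r : MvPolynomial (Fin n) ℂ)) := by
    rw [Finset.mul_sum, Finset.mul_sum, ← Finset.sum_add_distrib, ← Finset.sum_add_distrib,
      ← Finset.sum_sub_distrib]
    refine Finset.sum_congr rfl fun r _ => ?_
    rw [lie_mid_zero]
    simp only [C_sub, C_add, C_mul]
    ring
  rw [h4, mul_sub, C_sub, mul_comm (act p lam B.1 1)]
  ring

/-- Induction on the degree: by `act_X_mul` and the Jacobi identity both sides have the same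
commutators with the `y_i`, so equality propagates from `1`. -/
theorem act_lie (lam : ℂ) (A B : soG p n) (f : MvPolynomial (Fin n) ℂ) :
    act p lam (⁅A, B⁆ : soG p n).1 f =
      act p lam A.1 (act p lam B.1 f) - act p lam B.1 (act p lam A.1 f) := by
  induction f using MvPolynomial.induction_on generalizing A B with
  | C a =>
    rw [show (C a : MvPolynomial (Fin n) ℂ) = a • 1 by rw [smul_eq_C_mul, mul_one]]
    simp only [map_smul]
    rw [act_act_one, smul_sub]
  | add f g hf hg => simp only [map_add, hf, hg]; ring
  | mul_X f i hf =>
    have hj : ⁅⁅A, B⁆, lower p i⁆ = ⁅⁅A, lower p i⁆, B⁆ + ⁅A, ⁅B, lower p i⁆⁆ := by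
      have h1 := leibniz_lie A B (lower p i)
      have h2 := leibniz_lie B A (lower p i)
      rw [lie_lie, ← lie_skew ⁅A, lower p i⁆ B]
      abel
    rw [mul_comm]
    simp only [act_X_mul, map_add]
    have ha : (⁅⁅A, lower p i⁆, B⁆ + ⁅A, ⁅B, lower p i⁆⁆ : soG p n).1 =
      (⁅⁅A, lower p i⁆, B⁆ : soG p n).1 + (⁅A, ⁅B, lower p i⁆⁆ : soG p n).1 := rfl
    rw [hj, ha, act_add, hf ⁅A, lower p i⁆ B, hf A ⁅B, lower p i⁆, hf A B]
    ring

/-- Polynomials, as a carrier of the `𝔤`-module `M_𝔭^𝔤(lam)`. -/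
def PolyMod (_p n : ℕ) (_lam : ℂ) : Type := MvPolynomial (Fin n) ℂ

variable {lam : ℂ}

noncomputable instance : AddCommGroup (PolyMod p n lam) :=
  inferInstanceAs (AddCommGroup (MvPolynomial (Fin n) ℂ))

noncomputable instance : Module ℂ (PolyMod p n lam) :=
  inferInstanceAs (Module ℂ (MvPolynomial (Fin n) ℂ))

noncomputable instance : LieRingModule (soG p n) (PolyMod p n lam) where
  bracket A f := act p lam A.1 f
  add_lie A B f := act_add lam A.1 B.1 f
  lie_add A f g := map_add (act p lam A.1) f g
  leibniz_lie A B f := by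
    change act p lam A.1 (act p lam B.1 f) = act p lam (⁅A, B⁆ : soG p n).1 f +
      act p lam B.1 (act p lam A.1 f)
    exact (sub_eq_iff_eq_add.mp (act_lie lam A B f).symm)

noncomputable instance : LieModule ℂ (soG p n) (PolyMod p n lam) where
  smul_lie z A f := act_smul lam z A.1 f
  lie_smul z A f := map_smul (act p lam A.1) z f

variable (p n lam) in
/-- The identity map from polynomials to the `𝔤`-module carried by them. -/
noncomputable def toPolyMod : MvPolynomial (Fin n) ℂ ≃ₗ[ℂ] PolyMod p n lam :=
  LinearEquiv.refl ℂ (MvPolynomial (Fin n) ℂ)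

theorem lie_toPolyMod (A : soG p n) (f : MvPolynomial (Fin n) ℂ) :
    ⁅A, toPolyMod p n lam f⁆ = toPolyMod p n lam (act p lam A.1 f) := rfl

theorem exists_span_lower_sub_mem (A : soG p n) :
    ∃ y ∈ Submodule.span ℂ (Set.range (lower p (n := n))), A - y ∈ parG p n := by
  refine ⟨∑ i, A.1 (mid i) 0 • lower p i, Submodule.sum_mem _ fun i _ =>
    Submodule.smul_mem _ _ (Submodule.subset_span ⟨i, rfl⟩), ?_⟩
  intro a ha
  have h : (A - ∑ i, A.1 (mid i) 0 • lower p i : soG p n).1 =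
      A.1 - ∑ i, A.1 (mid i) 0 • (lower p i).1 := by
    simp
  rw [h, Matrix.sub_apply, Matrix.sum_apply]
  simp only [Matrix.smul_apply]
  induction a using fin_add_two_cases with
  | h0 => exact absurd rfl ha
  | hm r => simp [lower_apply_mid_zero]
  | hl => simp [soG_apply_last_zero]

/-- `M_𝔭^𝔤(lam)` is realised on polynomials. -/
theorem exists_vermaG_equiv (p n : ℕ) (lam : ℂ) :
    Nonempty (VermaG p n lam ≃ₗ⁅ℂ, soG p n⁆ PolyMod p n lam) := by
  obtain ⟨e, -⟩ := GenVerma.exists_equiv (P := parG p n) (ρ := charG p n lam)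
    (lower p (n := n)) lie_lower_lower exists_span_lower_sub_mem (toPolyMod p n lam).toLinearMap
    (fun i f => by
      change _ = ⁅lower p i, toPolyMod p n lam f⁆
      rw [lie_toPolyMod, act_lower]; rfl)
    (fun A => by
      change ⁅(A : soG p n), toPolyMod p n lam 1⁆ = (lam * A.1.1 0 0 * 1) • toPolyMod p n lam 1
      rw [lie_toPolyMod, ← map_smul, act_one, smul_eq_C_mul, mul_one, mul_one]
      congr 1
      rw [Finset.sum_eq_zero, zero_add]
      intro i _
      rw [A.2 _ (mid_ne_zero i), C_0, zero_mul])
    (toPolyMod p n lam).bijective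
  exact ⟨e⟩

end Conformal

/-! ### Rotation invariant polynomials and singular vectors -/

namespace Conformal

open MvPolynomial

variable {p d : ℕ}

/-- The quadratic form in the first `d` variables. -/
noncomputable def quad (p d : ℕ) : MvPolynomial (Fin (d + 1)) ℂ :=
  ∑ i : Fin d, C (eps p i) * X i.castSucc ^ 2

/-- The Euler derivation in the first `d` variables. -/
noncomputable def euler' (d : ℕ) :
    Derivation ℂ (MvPolynomial (Fin (d + 1)) ℂ) (MvPolynomial (Fin (d + 1)) ℂ) :=
  ∑ i : Fin d, (X i.castSucc : MvPolynomial (Fin (d + 1)) ℂ) •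
    (pderiv i.castSucc : Derivation ℂ (MvPolynomial (Fin (d + 1)) ℂ) (MvPolynomial (Fin (d + 1)) ℂ))

theorem euler'_apply (f : MvPolynomial (Fin (d + 1)) ℂ) :
    euler' d f = ∑ i : Fin d, X i.castSucc * pderiv i.castSucc f := by
  simp [euler', derivation_sum_apply]

theorem euler'_X_last : euler' d (X (Fin.last d)) = 0 := by
  rw [euler'_apply]
  refine Finset.sum_eq_zero fun i _ => ?_
  rw [pderiv_X_of_ne (Fin.castSucc_lt_last i).ne', mul_zero]

theorem euler'_X_castSucc (i : Fin d) : euler' d (X i.castSucc) = X i.castSucc := by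
  rw [euler'_apply, Finset.sum_eq_single i]
  · rw [pderiv_X_self, mul_one]
  · intro j _ hj
    rw [pderiv_X_of_ne (fun h => hj (Fin.castSucc_injective _ h).symm), mul_zero]
  · simp

theorem euler_apply (f : MvPolynomial (Fin (d + 1)) ℂ) :
    euler (d + 1) f = euler' d f + X (Fin.last d) * pderiv (Fin.last d) f := by
  have : euler (d + 1) = euler' d + (X (Fin.last d) : MvPolynomial (Fin (d + 1)) ℂ) •
      (pderiv (Fin.last d) :
        Derivation ℂ (MvPolynomial (Fin (d + 1)) ℂ) (MvPolynomial (Fin (d + 1)) ℂ)) := by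
    apply derivation_ext
    intro c
    rw [Derivation.add_apply, Derivation.smul_apply, smul_eq_mul, euler_X]
    induction c using Fin.lastCases with
    | last => rw [euler'_X_last, pderiv_X_self]; ring
    | cast i => rw [euler'_X_castSucc, pderiv_X_of_ne (Fin.castSucc_lt_last i).ne]; ring
  rw [this]; rfl

theorem euler_pderiv {n : ℕ} (i : Fin n) (f : MvPolynomial (Fin n) ℂ) :
    euler n (pderiv i f) = pderiv i (euler n f) - pderiv i f := by
  have : ⁅euler n, (pderiv i : Derivation ℂ (MvPolynomial (Fin n) ℂ) (MvPolynomial (Fin n) ℂ))⁆ =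
      - (pderiv i : Derivation ℂ (MvPolynomial (Fin n) ℂ) (MvPolynomial (Fin n) ℂ)) := by
    apply derivation_ext
    intro k
    rw [Derivation.commutator_apply, euler_X, pderiv_X, Derivation.neg_apply, pderiv_X]
    simp only [Pi.single_apply]
    split_ifs <;> simp
  have h := DFunLike.congr_fun this f
  rw [Derivation.commutator_apply, Derivation.neg_apply] at h
  linear_combination h

theorem pderiv_quad (i : Fin d) :
    pderiv i.castSucc (quad p d) = C (2 * eps p i) * X i.castSucc := by
  rw [quad, map_sum, Finset.sum_eq_single i]
  · simp only [pderiv_C_mul, Derivation.leibniz_pow, pderiv_X_self, C_mul]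
    rw [map_ofNat C 2]
    simp
    ring
  · intro j _ hj
    rw [pderiv_C_mul, Derivation.leibniz_pow,
      pderiv_X_of_ne (fun h => hj (Fin.castSucc_injective _ h)), smul_zero, smul_zero, mul_zero]
  · simp

theorem pderiv_last_quad : pderiv (Fin.last d) (quad p d) = 0 := by
  rw [quad, map_sum]
  refine Finset.sum_eq_zero fun i _ => ?_
  rw [pderiv_C_mul, Derivation.leibniz_pow, pderiv_X_of_ne (Fin.castSucc_lt_last i).ne, smul_zero,
    smul_zero, mul_zero]

theorem euler'_quad : euler' d (quad p d) = 2 * quad p d := by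
  rw [euler'_apply]
  conv_rhs => rw [quad, Finset.mul_sum]
  refine Finset.sum_congr rfl fun i _ => ?_
  rw [pderiv_quad, C_mul, map_ofNat]; ring

theorem quad_ne_zero (hd : 0 < d) : quad p d ≠ 0 := by
  intro h
  have h1 := pderiv_quad (p := p) (⟨0, hd⟩ : Fin d)
  rw [h, map_zero] at h1
  have h2 := mul_ne_zero (C_ne_zero.mpr (mul_ne_zero two_ne_zero (eps_ne_zero (p := p) (⟨0, hd⟩ : Fin d))))
    (X_ne_zero (R := ℂ) (⟨0, hd⟩ : Fin d).castSucc)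
  exact h2 h1.symm

/-- Invariance under the rotations of the first `d` variables. -/
def RotInv (p : ℕ) {d : ℕ} (w : MvPolynomial (Fin (d + 1)) ℂ) : Prop :=
  ∀ i j : Fin d, C (eps p j) * X i.castSucc * pderiv j.castSucc w =
    C (eps p i) * X j.castSucc * pderiv i.castSucc w

theorem C_eps_mul_self {n : ℕ} (i : Fin n) :
    (C (eps p i) * C (eps p i) : MvPolynomial (Fin (d + 1)) ℂ) = 1 := by
  rw [← C_mul, eps_mul_self, C_1]

/-- For a function of `s` and `t` this is the chain rule, `∂_j w = 2 ε_j y_j ∂_s w` and `E' w = 2 s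
∂_s w`. Multiplying the invariance relations by `y_i` and signs and summing over `i` gives it
without writing `w` through `s` and `t`. -/
theorem RotInv.quad_mul_pderiv {w : MvPolynomial (Fin (d + 1)) ℂ} (h : RotInv p w) (j : Fin d) :
    quad p d * pderiv j.castSucc w = C (eps p j) * X j.castSucc * euler' d w := by
  rw [quad, euler'_apply, Finset.sum_mul, Finset.mul_sum]
  refine Finset.sum_congr rfl fun i _ => ?_
  linear_combination C (eps p i) * C (eps p j) * X i.castSucc * h i j -
    C (eps p i) * X i.castSucc ^ 2 * pderiv j.castSucc w * C_eps_mul_self (p := p) (d := d) j +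
    C (eps p j) * X i.castSucc * X j.castSucc * pderiv i.castSucc w *
      C_eps_mul_self (p := p) (d := d) i

theorem lap_eq_add (f : MvPolynomial (Fin (d + 1)) ℂ) : lap p (d + 1) f =
    ∑ i : Fin d, C (eps p i) * pderiv i.castSucc (pderiv i.castSucc f) +
      C (eps p (Fin.last d)) * pderiv (Fin.last d) (pderiv (Fin.last d) f) := by
  rw [lap_apply, Fin.sum_univ_castSucc]
  rfl

/-- The radial part of the Laplacian in `d` variables, obtained by applying `∂_j` to
`RotInv.quad_mul_pderiv` and summing over `j`. -/
theorem RotInv.quad_mul_lap {w : MvPolynomial (Fin (d + 1)) ℂ} (h : RotInv p w) :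
    quad p d * ∑ i : Fin d, C (eps p i) * pderiv i.castSucc (pderiv i.castSucc w) =
      euler' d (euler' d w) + C ((d : ℂ) - 2) * euler' d w := by
  have h1 : ∀ j : Fin d, quad p d * (C (eps p j) * pderiv j.castSucc (pderiv j.castSucc w)) =
      euler' d w + X j.castSucc * pderiv j.castSucc (euler' d w) -
        2 * (X j.castSucc * pderiv j.castSucc w) := by
    intro j
    have := congrArg (pderiv j.castSucc) (h.quad_mul_pderiv j)
    rw [mul_assoc, pderiv_C_mul] at this
    simp only [Derivation.leibniz, smul_eq_mul, pderiv_X_self, pderiv_quad, C_mul,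
      map_ofNat] at this
    linear_combination C (eps p j) * this +
      (euler' d w + X j.castSucc * pderiv j.castSucc (euler' d w) - 2 *
        (X j.castSucc * pderiv j.castSucc w)) * C_eps_mul_self (p := p) (d := d) j
  rw [Finset.mul_sum, Finset.sum_congr rfl fun j _ => h1 j, Finset.sum_sub_distrib,
    Finset.sum_add_distrib, ← euler'_apply, ← Finset.mul_sum, ← euler'_apply, Finset.sum_const,
    Finset.card_univ, Fintype.card_fin, nsmul_eq_mul, C_sub, map_natCast, map_ofNat]
  ring

/-- The operator with `s · P_j = ε_j y_j · singOp` on rotation invariant polynomials of degree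
`N`. -/
noncomputable def singOp (p : ℕ) (lam N : ℂ) (w : MvPolynomial (Fin (d + 1)) ℂ) :
    MvPolynomial (Fin (d + 1)) ℂ :=
  C (1 / 2) * (euler' d (euler' d w) + C ((d : ℂ) - 2) * euler' d w) +
    C (eps p (Fin.last d) / 2) * (quad p d * pderiv (Fin.last d) (pderiv (Fin.last d) w)) -
    C (N - 1 - lam) * euler' d w

theorem singOp_add (lam N : ℂ) (v w : MvPolynomial (Fin (d + 1)) ℂ) :
    singOp p lam N (v + w) = singOp p lam N v + singOp p lam N w := by
  simp only [singOp, map_add]; ring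

theorem singOp_C_mul (lam N z : ℂ) (w : MvPolynomial (Fin (d + 1)) ℂ) :
    singOp p lam N (C z * w) = C z * singOp p lam N w := by
  simp only [singOp, ← smul_eq_C_mul, Derivation.map_smul]
  simp only [smul_eq_C_mul]; ring

theorem singOp_sum {ι : Type*} (s : Finset ι) (lam N : ℂ) (w : ι → MvPolynomial (Fin (d + 1)) ℂ) :
    singOp p lam N (∑ i ∈ s, w i) = ∑ i ∈ s, singOp p lam N (w i) := by
  classical
  induction s using Finset.induction_on with
  | empty => simp [singOp]
  | insert a s ha ih => rw [Finset.sum_insert ha, Finset.sum_insert ha, singOp_add, ih]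

/-- All `d` second order equations collapse to the single operator `singOp`. Homogeneity turns `E
∂_j w` into `(N - 1) ∂_j w`, and the factor `s` clears the denominator of the radial Laplacian. -/
theorem RotInv.quad_mul_raise {w : MvPolynomial (Fin (d + 1)) ℂ} (h : RotInv p w) {lam N : ℂ}
    (hN : euler (d + 1) w = C N * w) (j : Fin d) :
    quad p d * raise p lam j.castSucc w = C (eps p j) * X j.castSucc * singOp p lam N w := by
  have h1 := h.quad_mul_pderiv j
  have h2 := h.quad_mul_lap
  have he : eps p j.castSucc = eps p j := rfl
  rw [raise_apply, euler_pderiv, hN, pderiv_C_mul, lap_eq_add, singOp, he]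
  have e1 : (C (eps p j / 2) : MvPolynomial (Fin (d + 1)) ℂ) = C (eps p j) * C (1 / 2) := by
    rw [← C_mul]; congr 1; ring
  have e2 : (C (eps p (Fin.last d) / 2) : MvPolynomial (Fin (d + 1)) ℂ) =
      C (eps p (Fin.last d)) * C (1 / 2) := by
    rw [← C_mul]; congr 1; ring
  rw [e1, e2]
  simp only [C_sub, C_1] at h2 ⊢
  linear_combination C (eps p j) * C (1 / 2) * X j.castSucc * h2 - (C N - 1 - C lam) * h1

theorem RotInv.mul {v w : MvPolynomial (Fin (d + 1)) ℂ} (hv : RotInv p v) (hw : RotInv p w) :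
    RotInv p (v * w) := by
  intro i j
  simp only [Derivation.leibniz, smul_eq_mul]
  linear_combination w * hv i j + v * hw i j

theorem RotInv.pow {w : MvPolynomial (Fin (d + 1)) ℂ} (hw : RotInv p w) (m : ℕ) :
    RotInv p (w ^ m) := by
  induction m with
  | zero => intro i j; simp
  | succ m ih => rw [pow_succ]; exact ih.mul hw

theorem rotInv_C (z : ℂ) : RotInv p (C z : MvPolynomial (Fin (d + 1)) ℂ) := by
  intro i j; simp

theorem rotInv_sum {ι : Type*} (s : Finset ι) {w : ι → MvPolynomial (Fin (d + 1)) ℂ}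
    (h : ∀ i ∈ s, RotInv p (w i)) : RotInv p (∑ i ∈ s, w i) := by
  intro i j
  simp only [map_sum, Finset.mul_sum]
  exact Finset.sum_congr rfl fun k hk => h k hk i j

theorem rotInv_quad : RotInv p (quad p d) := by
  intro i j
  rw [pderiv_quad, pderiv_quad, C_mul, C_mul]
  linear_combination C 2 * X i.castSucc * X j.castSucc * (C_eps_mul_self (p := p) (d := d) j -
    C_eps_mul_self (p := p) (d := d) i)

theorem rotInv_X_last : RotInv p (X (Fin.last d)) := by
  intro i j
  rw [pderiv_X_of_ne (Fin.castSucc_lt_last _).ne', pderiv_X_of_ne (Fin.castSucc_lt_last _).ne']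
  ring

theorem euler'_quad_pow (m : ℕ) : euler' d (quad p d ^ m) = C (2 * m : ℂ) * quad p d ^ m := by
  cases m with
  | zero => simp
  | succ m =>
    rw [Derivation.leibniz_pow, euler'_quad]
    simp only [nsmul_eq_mul, smul_eq_mul, C_mul, map_natCast, map_ofNat, Nat.add_sub_cancel]
    ring

/-! ### Monomials in s and t, and the two-term recursion -/

/-- The monomial `s^m t^l`. -/
noncomputable def stMon (p d m l : ℕ) : MvPolynomial (Fin (d + 1)) ℂ :=
  quad p d ^ m * X (Fin.last d) ^ l

theorem rotInv_stMon (m l : ℕ) : RotInv p (stMon p d m l) :=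
  (rotInv_quad.pow m).mul (rotInv_X_last.pow l)

theorem euler'_stMon (m l : ℕ) : euler' d (stMon p d m l) = C (2 * m : ℂ) * stMon p d m l := by
  rw [stMon, Derivation.leibniz, euler'_quad_pow, Derivation.leibniz_pow, euler'_X_last]
  simp only [smul_eq_mul]; ring

theorem pderiv_last_stMon (m l : ℕ) :
    pderiv (Fin.last d) (stMon p d m l) = C (l : ℂ) * stMon p d m (l - 1) := by
  rw [stMon, Derivation.leibniz, Derivation.leibniz_pow, Derivation.leibniz_pow, pderiv_X_self,
    pderiv_last_quad, stMon, map_natCast]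
  simp only [smul_eq_mul, nsmul_eq_mul]; ring

theorem euler_stMon (m l : ℕ) :
    euler (d + 1) (stMon p d m l) = C (2 * m + l : ℂ) * stMon p d m l := by
  rw [euler_apply, euler'_stMon, pderiv_last_stMon]
  cases l with
  | zero => simp
  | succ l =>
    rw [C_add, Nat.add_sub_cancel, stMon, stMon, pow_succ]; ring

theorem singOp_stMon (lam N : ℂ) (m l : ℕ) : singOp p lam N (stMon p d m l) =
    C (m * (2 * m + d + 2 * lam - 2 * N)) * stMon p d m l +
      C (eps p (Fin.last d) / 2 * l * (l - 1)) * stMon p d (m + 1) (l - 2) := by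
  -- Truncated and true subtraction differ only at `l = 0`, where the factor `l` hides it.
  have hl : (C ((l - 1 : ℕ) : ℂ) * C (l : ℂ) : MvPolynomial (Fin (d + 1)) ℂ) =
      C (l - 1 : ℂ) * C (l : ℂ) := by
    cases l <;> simp
  have h1 : ∀ f, pderiv (Fin.last d) (C (l : ℂ) * f) = C (l : ℂ) * pderiv (Fin.last d) f := by
    intro f; rw [pderiv_C_mul]
  have h2 : ∀ f, euler' d (C (2 * m : ℂ) * f) = C (2 * m : ℂ) * euler' d f := by
    intro f; rw [← smul_eq_C_mul, Derivation.map_smul, smul_eq_C_mul]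
  have h3 : quad p d * stMon p d m (l - 2) = stMon p d (m + 1) (l - 2) := by
    rw [stMon, stMon, pow_succ]; ring
  rw [singOp, euler'_stMon, h2, euler'_stMon, pderiv_last_stMon, h1, pderiv_last_stMon,
    Nat.sub_sub, ← h3]
  have h4 : (C (m * (2 * m + d + 2 * lam - 2 * N)) : MvPolynomial (Fin (d + 1)) ℂ) =
      C (1 / 2) * (C (2 * m : ℂ) * C (2 * m : ℂ) + C (d - 2 : ℂ) * C (2 * m : ℂ)) -
        C (N - 1 - lam) * C (2 * m : ℂ) := by
    simp only [← C_mul, ← C_add, ← C_sub]; congr 1; ring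
  have h5 : (C (eps p (Fin.last d) / 2 * l * (l - 1)) : MvPolynomial (Fin (d + 1)) ℂ) =
      C (eps p (Fin.last d) / 2) * (C (l - 1 : ℂ) * C (l : ℂ)) := by
    simp only [← C_mul]; congr 1; ring
  rw [h4, h5, ← hl]
  ring

/-- The polynomial `∑ c_m s^m t^(N - 2m)`. -/
noncomputable def stPoly (p d N : ℕ) (c : ℕ → ℂ) : MvPolynomial (Fin (d + 1)) ℂ :=
  ∑ m ∈ Finset.range (N / 2 + 1), C (c m) * stMon p d m (N - 2 * m)

theorem rotInv_stPoly (N : ℕ) (c : ℕ → ℂ) : RotInv p (stPoly p d N c) :=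
  rotInv_sum _ fun m _ => (rotInv_C _).mul (rotInv_stMon m _)

theorem euler_stPoly (N : ℕ) (c : ℕ → ℂ) :
    euler (d + 1) (stPoly p d N c) = C (N : ℂ) * stPoly p d N c := by
  rw [stPoly, map_sum, Finset.mul_sum]
  refine Finset.sum_congr rfl fun m hm => ?_
  have : 2 * m ≤ N := by rw [Finset.mem_range] at hm; omega
  rw [← smul_eq_C_mul, Derivation.map_smul, euler_stMon, Nat.cast_sub this]
  simp only [smul_eq_C_mul]
  push_cast
  rw [add_sub_cancel]; ring

theorem singOp_stPoly (lam : ℂ) (N : ℕ) (c : ℕ → ℂ) : singOp p lam N (stPoly p d N c) =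
    ∑ m ∈ Finset.range (N / 2), C ((m + 1) * (2 * (m + 1) + d + 2 * lam - 2 * N) * c (m + 1) +
      eps p (Fin.last d) / 2 * (N - 2 * m) * (N - 2 * m - 1) * c m) *
        stMon p d (m + 1) (N - 2 * (m + 1)) := by
  have h : ∀ m ∈ Finset.range (N / 2 + 1), singOp p lam N (C (c m) * stMon p d m (N - 2 * m)) =
      C (m * (2 * m + d + 2 * lam - 2 * N) * c m) * stMon p d m (N - 2 * m) +
      C (eps p (Fin.last d) / 2 * (N - 2 * m) * (N - 2 * m - 1) * c m) *
        stMon p d (m + 1) (N - 2 * (m + 1)) := by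
    intro m hm
    have : 2 * m ≤ N := by rw [Finset.mem_range] at hm; omega
    rw [singOp_C_mul, singOp_stMon, Nat.cast_sub this, Nat.sub_sub]
    push_cast
    simp only [C_mul, mul_add]
    ring
  rw [stPoly, singOp_sum, Finset.sum_congr rfl h, Finset.sum_add_distrib, Finset.sum_range_succ',
    Finset.sum_range_succ _ (N / 2)]
  -- The top monomial has `t`-exponent 0 or 1, so `∂_t²` kills it; with the vanishing diagonal term
  -- at `m = 0` both sums have the same length.
  have h0 : ((N : ℂ) - 2 * (N / 2 : ℕ)) * ((N : ℂ) - 2 * (N / 2 : ℕ) - 1) = 0 := by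
    rcases Nat.mod_two_eq_zero_or_one N with h2 | h2
    · have : N = 2 * (N / 2) := by omega
      have : (N : ℂ) = 2 * (N / 2 : ℕ) := by exact_mod_cast this
      rw [← this]; ring
    · have : N = 2 * (N / 2) + 1 := by omega
      have : (N : ℂ) = 2 * (N / 2 : ℕ) + 1 := by exact_mod_cast this
      rw [← sub_eq_iff_eq_add'] at this
      rw [this]; ring
  rw [mul_assoc (eps p (Fin.last d) / 2) ((N : ℂ) - 2 * (N / 2 : ℕ)), h0]
  simp only [Nat.cast_zero, zero_mul, mul_zero, C_0, add_zero, ← Finset.sum_add_distrib]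
  refine Finset.sum_congr rfl fun m _ => ?_
  push_cast
  rw [C_add]; ring

theorem exists_rec_coeff (α h : ℕ → ℂ) (M : ℕ) (hα : ∀ m < M, α (m + 1) ≠ 0) :
    ∃ c : ℕ → ℂ, c 0 = 1 ∧ ∀ m < M, (m + 1) * α (m + 1) * c (m + 1) + h m * c m = 0 := by
  let c : ℕ → ℂ := fun m => Nat.rec 1 (fun m z => - (h m * z) / ((m + 1) * α (m + 1))) m
  refine ⟨c, rfl, fun m hm => ?_⟩
  have h1 : c (m + 1) = - (h m * c m) / ((m + 1) * α (m + 1)) := rfl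
  have h2 : ((m : ℂ) + 1) * α (m + 1) ≠ 0 := mul_ne_zero (Nat.cast_add_one_ne_zero m) (hα m hm)
  rw [h1, mul_div_cancel₀ _ h2]; ring

/-- The diagonal coefficient vanishes at index `l`, so the homogeneous recursion is obstructed there
by `κ = h (l-1) c (l-1)`. This is nonzero because no `h m` with `m < l` vanishes, and the
coefficients below `l` do not depend on `κ`, so there is no circularity. Past `l` the recursion is
solvable for any right-hand side, here `κ f`. -/
theorem exists_rec_coeff_of_zero (h f : ℕ → ℂ) (hf : f 0 = 1) (l : ℕ) (hl : 1 ≤ l)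
    (hh : ∀ m < l, h m ≠ 0) :
    ∃ (c : ℕ → ℂ) (κ : ℂ), κ ≠ 0 ∧ c 0 = 1 ∧
      ∀ m : ℕ, ((m : ℂ) + 1) * (2 * (m + 1 - l)) * c (m + 1) + h m * c m =
        κ * if m + 1 < l then 0 else f (m + 1 - l) := by
  -- At `m + 1 = l` the denominator is zero and the quotient is 0 by convention; this coefficient is
  -- free, so the value is harmless.
  let c : ℂ → ℕ → ℂ := fun κ m => Nat.rec 1
    (fun m z => ((κ * if m + 1 < l then 0 else f (m + 1 - l)) - h m * z) /
      (((m : ℂ) + 1) * (2 * (m + 1 - l)))) m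
  have hc : ∀ κ m, c κ (m + 1) = ((κ * if m + 1 < l then 0 else f (m + 1 - l)) - h m * c κ m) /
      (((m : ℂ) + 1) * (2 * (m + 1 - l))) := fun κ m => rfl
  have hne : ∀ m : ℕ, m + 1 ≠ l → ((m : ℂ) + 1) * (2 * (m + 1 - l)) ≠ 0 := by
    intro m hm
    refine mul_ne_zero (Nat.cast_add_one_ne_zero m) (mul_ne_zero two_ne_zero (sub_ne_zero.mpr ?_))
    exact_mod_cast hm
  have hlow : ∀ κ, ∀ m < l, c κ m = c 0 m ∧ c 0 m ≠ 0 := by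
    intro κ m
    induction m with
    | zero => intro _; exact ⟨rfl, one_ne_zero⟩
    | succ m ih =>
      intro hm
      obtain ⟨h1, h2⟩ := ih (by omega)
      rw [hc, hc, if_pos hm, h1, mul_zero, mul_zero]
      refine ⟨rfl, div_ne_zero ?_ (hne m hm.ne)⟩
      rw [zero_sub]
      exact neg_ne_zero.mpr (mul_ne_zero (hh m (by omega)) h2)
  refine ⟨c (h (l - 1) * c 0 (l - 1)), h (l - 1) * c 0 (l - 1),
    mul_ne_zero (hh _ (by omega)) (hlow 0 _ (by omega)).2, rfl, fun m => ?_⟩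
  by_cases hm : m + 1 = l
  · subst hm
    rw [Nat.add_sub_cancel, (hlow (h m * c 0 m) m (by omega)).1]
    simp [hf]
  · rw [hc, mul_div_cancel₀ _ (hne m hm)]; ring

/-! ### Leading terms in the last variable -/

/-- Polynomials in `d + 1` variables, as polynomials in the last variable. -/
noncomputable def lastEquiv (d : ℕ) :
    MvPolynomial (Fin (d + 1)) ℂ ≃ₐ[ℂ] Polynomial (MvPolynomial (Fin d) ℂ) :=
  (renameEquiv ℂ finSuccEquivLast).trans (optionEquivLeft ℂ (Fin d))

theorem lastEquiv_X_last : lastEquiv d (X (Fin.last d)) = Polynomial.X := by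
  simp [lastEquiv, finSuccEquivLast_last]

theorem lastEquiv_X_castSucc (i : Fin d) : lastEquiv d (X i.castSucc) = Polynomial.C (X i) := by
  simp [lastEquiv, finSuccEquivLast_castSucc]

theorem lastEquiv_C (z : ℂ) : lastEquiv d (C z) = Polynomial.C (C z) := by
  simp [lastEquiv]

theorem lastEquiv_rename (r : MvPolynomial (Fin d) ℂ) :
    lastEquiv d (rename Fin.castSucc r) = Polynomial.C r := by
  induction r using MvPolynomial.induction_on with
  | C a => rw [rename_C, lastEquiv_C]
  | add f g hf hg => simp only [map_add, hf, hg]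
  | mul_X f i hf => simp only [map_mul, hf, rename_X, lastEquiv_X_castSucc]

theorem exists_lastEquiv_quad : ∃ r : MvPolynomial (Fin d) ℂ, lastEquiv d (quad p d) = Polynomial.C r := by
  refine ⟨∑ i, C (eps p i) * X i ^ 2, ?_⟩
  simp only [quad, map_sum, map_mul, map_pow, lastEquiv_C, lastEquiv_X_castSucc]

/-- The form `s` does not involve `t`, so every term with `m > 0` has `t`-degree below `N`. -/
theorem lastEquiv_stPoly_monic (N : ℕ) (c : ℕ → ℂ) (hc : c 0 = 1) :
    (lastEquiv d (stPoly p d N c)).Monic ∧ (lastEquiv d (stPoly p d N c)).degree = N := by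
  obtain ⟨r, hr⟩ := exists_lastEquiv_quad (p := p) (d := d)
  have h : lastEquiv d (stPoly p d N c) = Polynomial.X ^ N + ∑ m ∈ Finset.range (N / 2),
      Polynomial.C (C (c (m + 1)) * r ^ (m + 1)) * Polynomial.X ^ (N - 2 * (m + 1)) := by
    rw [stPoly, Finset.sum_range_succ', map_add, map_sum, hc, add_comm]
    simp only [stMon, map_mul, map_pow, lastEquiv_C, lastEquiv_X_last, hr]
    simp [mul_assoc]
  have hdeg : (∑ m ∈ Finset.range (N / 2), Polynomial.C (C (c (m + 1)) * r ^ (m + 1)) *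
      Polynomial.X ^ (N - 2 * (m + 1)) : Polynomial (MvPolynomial (Fin d) ℂ)).degree < N := by
    refine (Polynomial.degree_sum_le _ _).trans_lt ?_
    refine (Finset.sup_lt_iff (WithBot.bot_lt_coe N)).mpr fun m hm => ?_
    rw [Finset.mem_range] at hm
    refine (Polynomial.degree_C_mul_X_pow_le _ _).trans_lt ?_
    exact Nat.cast_lt.mpr (by omega)
  rw [h]
  refine ⟨Polynomial.monic_X_pow_add hdeg, ?_⟩
  rw [Polynomial.degree_add_eq_left_of_degree_lt (by rwa [Polynomial.degree_X_pow]),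
    Polynomial.degree_X_pow]

/-- A rotation invariant homogeneous polynomial of degree `N` which is monic of degree `N` in the
last variable. -/
structure IsLeading (p : ℕ) {d : ℕ} (N : ℕ) (F : MvPolynomial (Fin (d + 1)) ℂ) : Prop where
  rotInv : RotInv p F
  euler_eq : euler (d + 1) F = C (N : ℂ) * F
  monic : (lastEquiv d F).Monic
  degree_eq : (lastEquiv d F).degree = N

theorem isLeading_stPoly (N : ℕ) (c : ℕ → ℂ) (hc : c 0 = 1) : IsLeading p N (stPoly p d N c) :=
  ⟨rotInv_stPoly N c, euler_stPoly N c, (lastEquiv_stPoly_monic N c hc).1,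
    (lastEquiv_stPoly_monic N c hc).2⟩

theorem IsLeading.ne_zero {N : ℕ} {F : MvPolynomial (Fin (d + 1)) ℂ} (h : IsLeading p N F) :
    F ≠ 0 := by
  rintro rfl
  have := h.monic
  rw [map_zero] at this
  exact this.ne_zero rfl

/-! ### Singular vectors and resonant pairs -/

theorem exists_singular_coeff (p d N : ℕ) (lam : ℂ)
    (hα : ∀ m < N / 2, 2 * ((m : ℂ) + 1) + d + 2 * lam - 2 * N ≠ 0) :
    ∃ c : ℕ → ℂ, c 0 = 1 ∧ singOp p lam N (stPoly p d N c) = 0 := by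
  obtain ⟨c, hc0, hc⟩ := exists_rec_coeff (fun m => 2 * (m : ℂ) + d + 2 * lam - 2 * N)
    (fun m => eps p (Fin.last d) / 2 * (N - 2 * m) * (N - 2 * m - 1)) (N / 2) (by
      intro m hm; push_cast; exact hα m hm)
  refine ⟨c, hc0, ?_⟩
  rw [singOp_stPoly]
  refine Finset.sum_eq_zero fun m hm => ?_
  have := hc m (Finset.mem_range.mp hm)
  push_cast at this
  rw [this, C_0, zero_mul]

theorem exists_singular (p d N : ℕ) (lam : ℂ)
    (hα : ∀ m < N / 2, 2 * ((m : ℂ) + 1) + d + 2 * lam - 2 * N ≠ 0) :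
    ∃ F : MvPolynomial (Fin (d + 1)) ℂ, IsLeading p N F ∧ singOp p lam N F = 0 := by
  obtain ⟨c, hc0, hc⟩ := exists_singular_coeff p d N lam hα
  exact ⟨_, isLeading_stPoly N c hc0, hc⟩

/-- In the resonant case there is a leading polynomial of degree `N = 2 l + a` which is only
singular modulo a singular vector of degree `a`. -/
theorem exists_singular_pair (p d a l : ℕ) (hl : 1 ≤ l) (lam : ℂ)
    (hlam : 2 * lam = 2 * (a + l : ℕ) - (d : ℂ)) :
    ∃ (F G : MvPolynomial (Fin (d + 1)) ℂ) (κ : ℂ), κ ≠ 0 ∧ IsLeading p a F ∧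
      singOp p lam a F = 0 ∧ IsLeading p (2 * l + a) G ∧
      singOp p lam (2 * l + a : ℕ) G = C κ * quad p d ^ l * F := by
  obtain ⟨f, hf0, hf⟩ := exists_singular_coeff p d a lam (by
    intro m _
    rw [add_sub_assoc, hlam]
    push_cast
    -- No resonance occurs in the lower degree `a`: the diagonal factor is the positive integer `2(m
    -- + 1) + 2l`.
    have : (2 * ((m : ℂ) + 1) + d + (2 * (a + l) - d - 2 * a)) = ((2 * (m + 1) + 2 * l : ℕ) : ℂ) := by
      push_cast; ring
    rw [this]
    exact Nat.cast_ne_zero.mpr (by omega))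
  obtain ⟨c, κ, hκ, hc0, hc⟩ := exists_rec_coeff_of_zero
    (fun m => eps p (Fin.last d) / 2 * ((2 * l + a : ℕ) - 2 * m) * ((2 * l + a : ℕ) - 2 * m - 1))
    f hf0 l hl (by
      intro m hm
      -- For `m < l` the `t`-exponent `2l + a - 2m` is at least 2, so the shift coefficient is
      -- nonzero.
      have h1 : (((2 * l + a : ℕ) : ℂ) - 2 * m) = ((2 * (l - m) + a : ℕ) : ℂ) := by
        push_cast [Nat.cast_sub hm.le]; ring
      have h2 : (((2 * l + a : ℕ) : ℂ) - 2 * m - 1) = ((2 * (l - m) + a - 1 : ℕ) : ℂ) := by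
        rw [h1, Nat.cast_sub (by omega)]; push_cast; ring
      rw [h2, h1]
      refine mul_ne_zero (mul_ne_zero (div_ne_zero (eps_ne_zero _) two_ne_zero)
        (Nat.cast_ne_zero.mpr (by omega))) (Nat.cast_ne_zero.mpr (by omega)))
  refine ⟨_, _, κ, hκ, isLeading_stPoly a f hf0, hf, isLeading_stPoly _ c hc0, ?_⟩
  rw [singOp_stPoly]
  have h1 : ∀ m : ℕ, 2 * ((m : ℂ) + 1) + d + 2 * lam - 2 * (2 * l + a : ℕ) = 2 * (m + 1 - l) := by
    intro m; rw [hlam]; push_cast; ring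
  simp only [h1, hc]
  -- The first `l - 1` summands of `singOp G` vanish; the other `a / 2 + 1` are `κ s^l` times the
  -- summands of `F`.
  have hN : (2 * l + a) / 2 = (l - 1) + (a / 2 + 1) := by omega
  rw [hN, Finset.sum_range_add, Finset.sum_eq_zero, zero_add, stPoly, Finset.mul_sum]
  · refine Finset.sum_congr rfl fun m _ => ?_
    rw [if_neg (by omega)]
    have e1 : l - 1 + m + 1 - l = m := by omega
    have e2 : l - 1 + m + 1 = l + m := by omega
    have e3 : 2 * l + a - 2 * (l + m) = a - 2 * m := by omega
    rw [e1, e2, e3, stMon, stMon, C_mul, pow_add]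
    ring
  · intro m hm
    rw [Finset.mem_range] at hm
    rw [if_pos (by omega), mul_zero, C_0, zero_mul]

theorem IsLeading.raise_eq_zero {N : ℕ} {F : MvPolynomial (Fin (d + 1)) ℂ} (h : IsLeading p N F)
    {lam : ℂ} (h0 : singOp p lam N F = 0) (j : Fin d) : raise p lam j.castSucc F = 0 := by
  have := h.rotInv.quad_mul_raise (lam := lam) h.euler_eq j
  rw [h0, mul_zero] at this
  exact (mul_eq_zero.mp this).resolve_left (quad_ne_zero (Fin.pos_iff_nonempty.mpr ⟨j⟩))

/-- Cancelling `s` keeps the result a ℂ[y_1, …, y_d]-multiple of `F`, which makes the span of `F`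
and `G` stable under 𝔤'. -/
theorem raise_eq_of_singOp {N : ℕ} {F G : MvPolynomial (Fin (d + 1)) ℂ} (h : IsLeading p N G)
    {lam κ : ℂ} {l : ℕ} (hl : 1 ≤ l) (h0 : singOp p lam N G = C κ * quad p d ^ l * F) (j : Fin d) :
    raise p lam j.castSucc G = C (eps p j) * X j.castSucc * C κ * quad p d ^ (l - 1) * F := by
  have := h.rotInv.quad_mul_raise (lam := lam) h.euler_eq j
  obtain ⟨l, rfl⟩ : ∃ m, l = m + 1 := ⟨l - 1, by omega⟩
  refine mul_left_cancel₀ (quad_ne_zero (p := p) (Fin.pos_iff_nonempty.mpr ⟨j⟩)) ?_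
  rw [this, h0, Nat.add_sub_cancel]; ring

theorem pderiv_last_rename (r : MvPolynomial (Fin d) ℂ) :
    pderiv (Fin.last d) (rename Fin.castSucc r) = 0 := by
  induction r using MvPolynomial.induction_on with
  | C a => rw [rename_C, pderiv_C]
  | add f g hf hg => rw [map_add, map_add, hf, hg, add_zero]
  | mul_X f i hf =>
    rw [map_mul, rename_X, Derivation.leibniz, hf, pderiv_X_of_ne (Fin.castSucc_lt_last i).ne,
      smul_zero, smul_zero, add_zero]

/-- Homogeneous multiples of resonant degree of a singular vector are annihilated by `singOp`. -/
theorem singOp_rename_mul {a l : ℕ} {F : MvPolynomial (Fin (d + 1)) ℂ} (h : IsLeading p a F)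
    {lam : ℂ} (h0 : singOp p lam a F = 0) (hlam : 2 * lam = 2 * (a + l : ℕ) - (d : ℂ))
    (r : MvPolynomial (Fin d) ℂ)
    (hw : euler (d + 1) (rename Fin.castSucc r * F) = C ((2 * l + a : ℕ) : ℂ) * (rename Fin.castSucc r * F)) :
    singOp p lam (2 * l + a : ℕ) (rename Fin.castSucc r * F) = 0 := by
  set R := rename Fin.castSucc r with hR
  have ht : pderiv (Fin.last d) R = 0 := pderiv_last_rename r
  -- `R` is free of `t`, and both `R F` and `F` are homogeneous, so `R` has degree `2 l`.
  have hE : euler' d R = C (2 * l : ℂ) * R := by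
    have h1 : euler (d + 1) R = euler' d R := by rw [euler_apply, ht, mul_zero, add_zero]
    rw [Derivation.leibniz, h.euler_eq, h1, smul_eq_mul, smul_eq_mul] at hw
    refine mul_right_cancel₀ h.ne_zero ?_
    push_cast at hw
    rw [C_add] at hw
    linear_combination hw
  have hEs : ∀ z f, euler' d (C z * f) = C z * euler' d f := by
    intro z f; rw [← smul_eq_C_mul, Derivation.map_smul, smul_eq_C_mul]
  have hEF : euler' d (R * F) = R * (euler' d F + C (2 * l : ℂ) * F) := by
    rw [Derivation.leibniz, hE, smul_eq_mul, smul_eq_mul]; ring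
  have hEEF : euler' d (euler' d (R * F)) = R * (euler' d (euler' d F) +
      C (4 * l : ℂ) * euler' d F + C (4 * l * l : ℂ) * F) := by
    rw [hEF, Derivation.leibniz, hE, map_add, hEs, smul_eq_mul, smul_eq_mul]
    have e1 : (C (4 * l : ℂ) : MvPolynomial (Fin (d + 1)) ℂ) = 2 * C (2 * l : ℂ) := by
      rw [← map_ofNat C, ← C_mul]; congr 1; ring
    have e2 : (C (4 * l * l : ℂ) : MvPolynomial (Fin (d + 1)) ℂ) = C (2 * l : ℂ) * C (2 * l : ℂ) := by
      rw [← C_mul]; congr 1; ring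
    rw [e1, e2]; ring
  have htt : pderiv (Fin.last d) (pderiv (Fin.last d) (R * F)) =
      R * pderiv (Fin.last d) (pderiv (Fin.last d) F) := by
    rw [Derivation.leibniz, ht, smul_zero, add_zero, smul_eq_mul, Derivation.leibniz, ht, smul_zero,
      add_zero, smul_eq_mul]
  rw [singOp, hEEF, hEF, htt]
  rw [singOp] at h0
  -- Passing from `F` to `R F` shifts both `E'` and `N` by `2l`. The changes in the coefficient of
  -- `E'` cancel, and the new constant term `l (2λ + d - 2(a + l))` is zero by resonance.
  have hcoef : (C (1 / 2) * (C (4 * l : ℂ)) - C (2 * l : ℂ) : MvPolynomial (Fin (d + 1)) ℂ) = 0 := by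
    rw [← C_mul, ← C_sub, C_eq_zero]; ring
  have hcoef2 : (C (1 / 2) * (C (4 * l * l : ℂ) + C ((d : ℂ) - 2) * C (2 * l : ℂ)) -
      C (((2 * l + a : ℕ) : ℂ) - 1 - lam) * C (2 * l : ℂ) : MvPolynomial (Fin (d + 1)) ℂ) = 0 := by
    simp only [← C_mul, ← C_add, ← C_sub, C_eq_zero]
    push_cast at hlam ⊢
    linear_combination (l : ℂ) * hlam
  have hsplit : (C (((2 * l + a : ℕ) : ℂ) - 1 - lam) : MvPolynomial (Fin (d + 1)) ℂ) =
      C (2 * l : ℂ) + C ((a : ℂ) - 1 - lam) := by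
    rw [← C_add]; congr 1; push_cast; ring
  linear_combination R * h0 + R * euler' d F * hcoef + R * F * hcoef2 -
    R * euler' d F * hsplit

end Conformal

/-! ### The action of `𝔤'` -/

namespace Conformal

open MvPolynomial

variable {p d : ℕ}

theorem gram_mul_single_zero {n : ℕ} (c : Fin (n + 2)) (z : ℂ) :
    gram p n * Matrix.single 0 c z = Matrix.single (Fin.last (n + 1)) c z := by
  ext a b
  have h2 : (0 : Fin (n + 2)) ≠ Fin.last (n + 1) := by simp [Fin.ext_iff]
  induction a using fin_add_two_cases with
  | h0 => rw [gram_mul_zero]; simp [h2, h2.symm]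
  | hm r =>
    rw [gram_mul_mid]; simp [(mid_ne_zero r).symm, (mid_ne_last r).symm]
  | hl => rw [gram_mul_last]; simp [Matrix.single_apply]

theorem gram_mul_single_last {n : ℕ} (c : Fin (n + 2)) (z : ℂ) :
    gram p n * Matrix.single (Fin.last (n + 1)) c z = Matrix.single 0 c z := by
  ext a b
  have h2 : (0 : Fin (n + 2)) ≠ Fin.last (n + 1) := by simp [Fin.ext_iff]
  induction a using fin_add_two_cases with
  | h0 => rw [gram_mul_zero]; simp [Matrix.single_apply]
  | hm r =>
    rw [gram_mul_mid]; simp [(mid_ne_zero r).symm, (mid_ne_last r).symm]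
  | hl => rw [gram_mul_last]; simp [h2, h2.symm]

theorem gram_mul_single_mid {n : ℕ} (i : Fin n) (c : Fin (n + 2)) (z : ℂ) :
    gram p n * Matrix.single (mid i) c z = Matrix.single (mid i) c (eps p i * z) := by
  ext a b
  induction a using fin_add_two_cases with
  | h0 => rw [gram_mul_zero]; simp [mid_ne_zero, mid_ne_last]
  | hm r =>
    rw [gram_mul_mid]
    by_cases h : i = r
    · subst h; simp [Matrix.single_apply]
    · simp [h]
  | hl => rw [gram_mul_last]; simp [mid_ne_zero, mid_ne_last]

theorem mem_soG_of_gram_mul_eq {n : ℕ} {A : Matrix (Fin (n + 2)) (Fin (n + 2)) ℂ} {z : ℂ}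
    {i j : Fin (n + 2)} (h : gram p n * A = Matrix.single i j z - Matrix.single j i z) :
    A ∈ soG p n := by
  rw [mem_soG_iff]
  intro a b
  rw [h]
  simp only [Matrix.sub_apply, Matrix.single_apply, and_comm]
  ring

theorem soG_apply_last_mid {n : ℕ} (X : soG p n) (r : Fin n) :
    eps p r * X.1 (mid r) 0 + X.1 (Fin.last (n + 1)) (mid r) = 0 := by
  have := (mem_soG_iff X.1).mp X.2 (mid r) 0
  rwa [gram_mul_zero, gram_mul_mid] at this

theorem mid_last : mid (Fin.last d) = (Fin.last (d + 1)).castSucc := rfl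

theorem soG'_apply_mid_last (A : soG' p (d + 1)) (i) : A.1.1 i (mid (Fin.last d)) = 0 := A.2 i

theorem soG'_apply_last_mid (A : soG' p (d + 1)) (c : Fin (d + 1)) :
    A.1.1 (mid (Fin.last d)) (mid c) = 0 := by
  have := soG_apply_mid_mid A.1 (Fin.last d) c
  rw [soG'_apply_mid_last, mul_zero, add_zero] at this
  exact (mul_eq_zero.mp this).resolve_left (eps_ne_zero _)

theorem soG'_apply_last_zero (A : soG' p (d + 1)) : A.1.1 (mid (Fin.last d)) 0 = 0 := by
  have := soG_apply_last_mid A.1 (Fin.last d)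
  rw [soG'_apply_mid_last, add_zero] at this
  exact (mul_eq_zero.mp this).resolve_left (eps_ne_zero _)

/-- The vectors `Y_i`, `i < d`, as elements of `𝔤'`. -/
def lower' (p : ℕ) {d : ℕ} (i : Fin d) : soG' p (d + 1) :=
  ⟨lower p i.castSucc, by
    intro a
    rw [← mid_last]
    induction a using fin_add_two_cases with
    | h0 => rw [lower_apply_zero]
    | hm r => rw [lower_apply_mid_mid]
    | hl => simp [lower_val, (mid_ne_zero _).symm]⟩

theorem lie_lower'_lower' (i j : Fin d) : ⁅lower' p i, lower' p j⁆ = 0 :=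
  Subtype.ext (lie_lower_lower i.castSucc j.castSucc)

theorem exists_span_lower'_sub_mem (A : soG' p (d + 1)) :
    ∃ y ∈ Submodule.span ℂ (Set.range (lower' p (d := d))), A - y ∈ parG' p (d + 1) := by
  refine ⟨∑ i : Fin d, A.1.1 (mid i.castSucc) 0 • lower' p i, Submodule.sum_mem _ fun i _ =>
    Submodule.smul_mem _ _ (Submodule.subset_span ⟨i, rfl⟩), ?_⟩
  change (A - ∑ i : Fin d, A.1.1 (mid i.castSucc) 0 • lower' p i : soG' p (d + 1)).1 ∈ parG p (d + 1)
  intro a ha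
  have h : (A - ∑ i : Fin d, A.1.1 (mid i.castSucc) 0 • lower' p i : soG' p (d + 1)).1.1 =
      A.1.1 - ∑ i : Fin d, A.1.1 (mid i.castSucc) 0 • (lower p i.castSucc).1 := by
    simp [lower']
  rw [h, Matrix.sub_apply, Matrix.sum_apply]
  simp only [Matrix.smul_apply]
  induction a using fin_add_two_cases with
  | h0 => exact absurd rfl ha
  | hm r =>
    simp only [lower_apply_mid_zero]
    induction r using Fin.lastCases with
    | last => simp [soG'_apply_last_zero]
    | cast r => simp [Fin.castSucc_inj]
  | hl => simp [soG_apply_last_zero]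

/-- The grading element. -/
def gradingElt (p d : ℕ) : soG' p (d + 1) :=
  ⟨⟨Matrix.single 0 0 1 - Matrix.single (Fin.last (d + 2)) (Fin.last (d + 2)) 1,
    mem_soG_of_gram_mul_eq (i := Fin.last (d + 2)) (j := 0) (z := 1) (by
      rw [mul_sub, gram_mul_single_zero, gram_mul_single_last])⟩, by
    intro a
    rw [← mid_last]
    simp [(mid_ne_zero _).symm, (mid_ne_last _).symm]⟩

/-- The infinitesimal rotations in `𝔤'`. -/
def rotElt (p : ℕ) {d : ℕ} (i j : Fin d) : soG' p (d + 1) :=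
  ⟨⟨Matrix.single (mid i.castSucc) (mid j.castSucc) (eps p j) -
      Matrix.single (mid j.castSucc) (mid i.castSucc) (eps p i),
    mem_soG_of_gram_mul_eq (i := mid i.castSucc) (j := mid j.castSucc) (z := eps p i * eps p j) (by
      rw [mul_sub, gram_mul_single_mid, gram_mul_single_mid, mul_comm (eps p j.castSucc)]
      rfl)⟩, by
    intro a
    rw [← mid_last]
    simp [(Fin.castSucc_lt_last _).ne]⟩

/-- The basis vectors of the nilradical of `𝔭'`. -/
def raiseElt (p : ℕ) {d : ℕ} (i : Fin d) : soG' p (d + 1) :=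
  ⟨⟨Matrix.single 0 (mid i.castSucc) 1 -
      Matrix.single (mid i.castSucc) (Fin.last (d + 2)) (eps p i.castSucc),
    mem_soG_of_gram_mul_eq (i := Fin.last (d + 2)) (j := mid i.castSucc) (z := 1) (by
      rw [mul_sub, gram_mul_single_zero, gram_mul_single_mid, eps_mul_self])⟩, by
    intro a
    rw [← mid_last]
    simp [(Fin.castSucc_lt_last _).ne, (mid_ne_last _).symm]⟩

theorem gradingElt_mem : gradingElt p d ∈ parG' p (d + 1) := by
  intro a ha
  have h2 : Fin.last (d + 2) ≠ 0 := by simp [Fin.ext_iff]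
  change (Matrix.single 0 0 1 - Matrix.single (Fin.last (d + 2)) (Fin.last (d + 2)) 1 :
    Matrix (Fin (d + 3)) (Fin (d + 3)) ℂ) a 0 = 0
  simp [Ne.symm ha, h2]

theorem rotElt_mem (i j : Fin d) : rotElt p i j ∈ parG' p (d + 1) := by
  intro a ha
  change (Matrix.single (mid i.castSucc) (mid j.castSucc) (eps p j) -
      Matrix.single (mid j.castSucc) (mid i.castSucc) (eps p i) :
    Matrix (Fin (d + 3)) (Fin (d + 3)) ℂ) a 0 = 0
  simp [mid_ne_zero]

theorem raiseElt_mem (i : Fin d) : raiseElt p i ∈ parG' p (d + 1) := by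
  intro a ha
  have h2 : Fin.last (d + 2) ≠ 0 := by simp [Fin.ext_iff]
  change (Matrix.single 0 (mid i.castSucc) 1 -
      Matrix.single (mid i.castSucc) (Fin.last (d + 2)) (eps p i.castSucc) :
    Matrix (Fin (d + 3)) (Fin (d + 3)) ℂ) a 0 = 0
  simp [mid_ne_zero, h2]

theorem gradingElt_val : (gradingElt p d).1.1 =
  Matrix.single 0 0 1 - Matrix.single (Fin.last (d + 2)) (Fin.last (d + 2)) 1 := rfl

theorem rotElt_val (i j : Fin d) : (rotElt p i j).1.1 =
  Matrix.single (mid i.castSucc) (mid j.castSucc) (eps p j) -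
      Matrix.single (mid j.castSucc) (mid i.castSucc) (eps p i) := rfl

theorem raiseElt_val (i : Fin d) : (raiseElt p i).1.1 = Matrix.single 0 (mid i.castSucc) 1 -
      Matrix.single (mid i.castSucc) (Fin.last (d + 2)) (eps p i.castSucc) := rfl

theorem act_gradingElt (lam : ℂ) (f : MvPolynomial (Fin (d + 1)) ℂ) :
    act p lam (gradingElt p d).1.1 f = C lam * f - euler (d + 1) f := by
  have h2 : Fin.last (d + 2) ≠ 0 := by simp [Fin.ext_iff]
  have hl : leviDer (gradingElt p d).1.1 = - euler (d + 1) := by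
    apply derivation_ext
    intro c
    rw [leviDer_X, Derivation.neg_apply, euler_X, gradingElt_val]
    simp [(mid_ne_zero _).symm, (mid_ne_last _).symm, h2]
  rw [act_apply, hl, gradingElt_val, Derivation.neg_apply]
  simp [(mid_ne_zero _).symm, h2]
  ring

theorem act_rotElt (lam : ℂ) (i j : Fin d) (f : MvPolynomial (Fin (d + 1)) ℂ) :
    act p lam (rotElt p i j).1.1 f = C (eps p j) * X i.castSucc * pderiv j.castSucc f -
      C (eps p i) * X j.castSucc * pderiv i.castSucc f := by
  have hl : leviDer (rotElt p i j).1.1 =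
      (C (eps p j) * X i.castSucc : MvPolynomial (Fin (d + 1)) ℂ) • (pderiv j.castSucc :
        Derivation ℂ (MvPolynomial (Fin (d + 1)) ℂ) (MvPolynomial (Fin (d + 1)) ℂ)) -
      (C (eps p i) * X j.castSucc : MvPolynomial (Fin (d + 1)) ℂ) • (pderiv i.castSucc :
        Derivation ℂ (MvPolynomial (Fin (d + 1)) ℂ) (MvPolynomial (Fin (d + 1)) ℂ)) := by
    apply derivation_ext
    intro c
    rw [leviDer_X, Derivation.sub_apply, Derivation.smul_apply, Derivation.smul_apply, rotElt_val,
      pderiv_X, pderiv_X]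
    have h1 : ∀ (a b : Fin (d + 1)) (z : ℂ), ∑ r, C ((Matrix.single (mid a) (mid b) z :
        Matrix (Fin (d + 3)) (Fin (d + 3)) ℂ) (mid r) (mid c)) * X r =
        (C z * X a) • (Pi.single b 1 : Fin (d + 1) → MvPolynomial (Fin (d + 1)) ℂ) c := by
      intro a b z
      by_cases h : b = c
      · subst h; simp [Matrix.single_apply, apply_ite]
      · simp [h, Ne.symm h]
    simp only [Matrix.sub_apply, C_sub, sub_mul, Finset.sum_sub_distrib, h1]
    simp [mid_ne_zero, Pi.single_apply]
  rw [act_apply, hl, rotElt_val]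
  simp [mid_ne_zero]

theorem act_raiseElt (lam : ℂ) (i : Fin d) (f : MvPolynomial (Fin (d + 1)) ℂ) :
    act p lam (raiseElt p i).1.1 f = raise p lam i.castSucc f := by
  have h2 : Fin.last (d + 2) ≠ 0 := by simp [Fin.ext_iff]
  have hl : leviDer (raiseElt p i).1.1 = 0 := by
    apply derivation_ext
    intro c
    rw [leviDer_X, raiseElt_val]
    simp [(mid_ne_zero _).symm, (mid_ne_last _).symm, mid_ne_zero]
  rw [act_apply, hl, raiseElt_val]
  simp [Matrix.single_apply, mid_ne_zero, h2, apply_ite]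

/-- Apart from the grading, the Levi part of 𝔤' consists of rotations. Antisymmetry up to the signs
ε pairs the term `(r, c)` with `(c, r)`, so on an invariant `F` the rotation sum equals its own
negative. -/
theorem leviDer_apply_of_rotInv (A : soG' p (d + 1)) {F : MvPolynomial (Fin (d + 1)) ℂ}
    (hF : RotInv p F) : leviDer A.1.1 F = - C (A.1.1 0 0) * euler (d + 1) F := by
  have hl : leviDer A.1.1 = ∑ r : Fin d, ∑ c : Fin d,
      (C (A.1.1 (mid r.castSucc) (mid c.castSucc)) * X r.castSucc : MvPolynomial (Fin (d + 1)) ℂ) •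
        (pderiv c.castSucc :
          Derivation ℂ (MvPolynomial (Fin (d + 1)) ℂ) (MvPolynomial (Fin (d + 1)) ℂ)) -
      (C (A.1.1 0 0) : MvPolynomial (Fin (d + 1)) ℂ) • euler (d + 1) := by
    apply derivation_ext
    intro c
    rw [leviDer_X, Derivation.sub_apply, Derivation.smul_apply, euler_X, smul_eq_mul,
      derivation_sum_apply, Fin.sum_univ_castSucc, soG'_apply_last_mid, C_0, zero_mul, add_zero]
    congr 1
    refine Finset.sum_congr rfl fun r _ => ?_
    rw [derivation_sum_apply]
    simp only [Derivation.smul_apply, smul_eq_mul]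
    induction c using Fin.lastCases with
    | last =>
      rw [soG'_apply_mid_last, C_0, zero_mul, Finset.sum_eq_zero]
      intro c _
      rw [pderiv_X_of_ne (Fin.castSucc_lt_last c).ne', mul_zero]
    | cast c =>
      rw [Finset.sum_eq_single c]
      · rw [pderiv_X_self, mul_one]
      · intro b _ hb
        rw [pderiv_X_of_ne (fun h => hb (Fin.castSucc_injective _ h).symm), mul_zero]
      · simp
  have hs : ∑ r : Fin d, ∑ c : Fin d, C (A.1.1 (mid r.castSucc) (mid c.castSucc)) * X r.castSucc *
      pderiv c.castSucc F = 0 := by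
    have h1 : ∀ r c : Fin d, C (A.1.1 (mid r.castSucc) (mid c.castSucc)) * X r.castSucc *
        pderiv c.castSucc F = - (C (A.1.1 (mid c.castSucc) (mid r.castSucc)) * X c.castSucc *
        pderiv r.castSucc F) := by
      intro r c
      have h2 : eps p r * A.1.1 (mid r.castSucc) (mid c.castSucc) +
        eps p c * A.1.1 (mid c.castSucc) (mid r.castSucc) = 0 :=
        soG_apply_mid_mid A.1 r.castSucc c.castSucc
      have h3 := congrArg (C (σ := Fin (d + 1))) h2
      rw [C_add, C_mul, C_mul, C_0] at h3
      have h4 := hF r c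
      linear_combination C (eps p r) * (X r.castSucc * pderiv c.castSucc F) * h3 -
        C (eps p r) * C (A.1.1 (mid c.castSucc) (mid r.castSucc)) * h4 -
        C (A.1.1 (mid r.castSucc) (mid c.castSucc)) * X r.castSucc * pderiv c.castSucc F *
          C_eps_mul_self (p := p) (d := d) r - C (A.1.1 (mid c.castSucc) (mid r.castSucc)) *
          X c.castSucc * pderiv r.castSucc F * C_eps_mul_self (p := p) (d := d) r
    have h5 : ∀ x : MvPolynomial (Fin (d + 1)) ℂ, x = -x → x = 0 := by
      intro x hx
      have : (2 : MvPolynomial (Fin (d + 1)) ℂ) * x = 0 := by linear_combination hx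
      exact (mul_eq_zero.mp this).resolve_left two_ne_zero
    apply h5
    conv_lhs => rw [Finset.sum_comm]
    rw [← Finset.sum_neg_distrib]
    refine Finset.sum_congr rfl fun r _ => ?_
    rw [← Finset.sum_neg_distrib]
    exact Finset.sum_congr rfl fun c _ => h1 c r
  rw [hl, Derivation.sub_apply, Derivation.smul_apply, derivation_sum_apply]
  simp only [derivation_sum_apply, Derivation.smul_apply, smul_eq_mul]
  rw [hs]; ring

/-- A leading polynomial of degree `N` behaves like a generator of weight `lam - N`, up to the terms
with `raise`; those are the only obstruction to being singular. -/
theorem IsLeading.act_eq {N : ℕ} {F : MvPolynomial (Fin (d + 1)) ℂ} (h : IsLeading p N F) (lam : ℂ)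
    (A : soG' p (d + 1)) : act p lam A.1.1 F =
      (∑ i : Fin d, C (A.1.1 (mid i.castSucc) 0) * X i.castSucc + C ((lam - N) * A.1.1 0 0)) * F +
        ∑ j : Fin d, C (A.1.1 0 (mid j.castSucc)) * raise p lam j.castSucc F := by
  rw [act_apply, leviDer_apply_of_rotInv A h.rotInv, h.euler_eq, Fin.sum_univ_castSucc,
    Fin.sum_univ_castSucc, soG'_apply_last_zero, soG'_apply_mid_last]
  simp only [C_0, zero_mul, add_zero, sub_mul, C_sub, C_mul]
  ring

/-! ### Submodules free over ℂ[y_1, …, y_d] -/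

/-- The span over `ℂ[y_1, …, y_d]` of the polynomials `f b`, `b ∈ s`. -/
noncomputable def freeSub (f : ℕ → MvPolynomial (Fin (d + 1)) ℂ) (s : Set ℕ) :
    Submodule ℂ (MvPolynomial (Fin (d + 1)) ℂ) :=
  ((Submodule.span (MvPolynomial (Fin d) ℂ) ((fun b => lastEquiv d (f b)) '' s)).restrictScalars
    ℂ).comap (lastEquiv d).toLinearMap

variable {f : ℕ → MvPolynomial (Fin (d + 1)) ℂ} {s : Set ℕ}

theorem mem_freeSub {x : MvPolynomial (Fin (d + 1)) ℂ} : x ∈ freeSub f s ↔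
    lastEquiv d x ∈ Submodule.span (MvPolynomial (Fin d) ℂ) ((fun b => lastEquiv d (f b)) '' s) :=
  Iff.rfl

theorem lastEquiv_rename_mul (r : MvPolynomial (Fin d) ℂ) (x : MvPolynomial (Fin (d + 1)) ℂ) :
    lastEquiv d (rename Fin.castSucc r * x) = r • lastEquiv d x := by
  rw [map_mul, lastEquiv_rename, Polynomial.smul_eq_C_mul]

theorem rename_mul_mem_freeSub (r : MvPolynomial (Fin d) ℂ) {x : MvPolynomial (Fin (d + 1)) ℂ}
    (hx : x ∈ freeSub f s) : rename Fin.castSucc r * x ∈ freeSub f s := by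
  rw [mem_freeSub, lastEquiv_rename_mul]
  exact Submodule.smul_mem _ _ hx

theorem X_mul_mem_freeSub (i : Fin d) {x : MvPolynomial (Fin (d + 1)) ℂ}
    (hx : x ∈ freeSub f s) : X i.castSucc * x ∈ freeSub f s := by
  have := rename_mul_mem_freeSub (X i) hx
  rwa [rename_X] at this

theorem C_mul_mem_freeSub (z : ℂ) {x : MvPolynomial (Fin (d + 1)) ℂ}
    (hx : x ∈ freeSub f s) : C z * x ∈ freeSub f s := by
  rw [← smul_eq_C_mul]; exact Submodule.smul_mem _ _ hx

theorem self_mem_freeSub {b : ℕ} (hb : b ∈ s) : f b ∈ freeSub f s :=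
  Submodule.subset_span ⟨b, hb, rfl⟩

theorem freeSub_mono {t : Set ℕ} (h : s ⊆ t) : freeSub f s ≤ freeSub f t :=
  fun _ hx => Submodule.span_mono (Set.image_mono h) hx

theorem quad_mul_mem_freeSub {x : MvPolynomial (Fin (d + 1)) ℂ} (m : ℕ)
    (hx : x ∈ freeSub f s) : quad p d ^ m * x ∈ freeSub f s := by
  obtain ⟨r, hr⟩ := exists_lastEquiv_quad (p := p) (d := d)
  rw [← lastEquiv_rename] at hr
  rw [(lastEquiv d).injective hr, ← map_pow]
  exact rename_mul_mem_freeSub _ hx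

/-- A submodule which is spanned over `ℂ[y_1, …, y_d]` by leading polynomials and contains their
images under the raising operators is a `𝔤'`-submodule. -/
theorem act_mem_freeSub {lam : ℂ} (hf : ∀ b ∈ s, IsLeading p b (f b))
    (hr : ∀ b ∈ s, ∀ j : Fin d, raise p lam j.castSucc (f b) ∈ freeSub f s)
    (A : soG' p (d + 1)) {x : MvPolynomial (Fin (d + 1)) ℂ} (hx : x ∈ freeSub f s) :
    act p lam A.1.1 x ∈ freeSub f s := by
  obtain ⟨y, rfl⟩ := (lastEquiv d).symm.surjective x
  rw [mem_freeSub, AlgEquiv.apply_symm_apply] at hx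
  induction hx using Submodule.span_induction generalizing A with
  | mem y hy =>
    obtain ⟨b, hb, rfl⟩ := hy
    simp only [AlgEquiv.symm_apply_apply]
    rw [(hf b hb).act_eq, add_mul, Finset.sum_mul]
    refine Submodule.add_mem _ (Submodule.add_mem _ (Submodule.sum_mem _ fun i _ => ?_)
      (C_mul_mem_freeSub _ (self_mem_freeSub hb)))
      (Submodule.sum_mem _ fun j _ => C_mul_mem_freeSub _ (hr b hb j))
    rw [mul_assoc]
    exact C_mul_mem_freeSub _ (X_mul_mem_freeSub _ (self_mem_freeSub hb))
  | zero => rw [map_zero, map_zero]; exact Submodule.zero_mem _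
  | add y z _ _ hy hz => rw [map_add, map_add]; exact Submodule.add_mem _ (hy A) (hz A)
  | smul r y _ hy =>
    let T : MvPolynomial (Fin d) ℂ →ₗ[ℂ] PolyMod p (d + 1) lam :=
      (toPolyMod p (d + 1) lam).toLinearMap ∘ₗ
        (LinearMap.mulRight ℂ ((lastEquiv d).symm y)) ∘ₗ (rename Fin.castSucc).toLinearMap
    have hT : ∀ r, T r = toPolyMod p (d + 1) lam (rename Fin.castSucc r * (lastEquiv d).symm y) :=
      fun r => rfl
    have hry : (lastEquiv d).symm (r • y) = rename Fin.castSucc r * (lastEquiv d).symm y := by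
      rw [AlgEquiv.symm_apply_eq, lastEquiv_rename_mul, AlgEquiv.apply_symm_apply]
    rw [hry]
    have hl : ∀ (A : soG' p (d + 1)) g, ⁅A, toPolyMod p (d + 1) lam g⁆ =
        toPolyMod p (d + 1) lam (act p lam A.1.1 g) := fun A g => rfl
    -- Multiplication by `r` is a polynomial in the `Y_i ∈ 𝔤'`, so stability for `r y` follows from
    -- stability for `y`, for all `A` at once.
    have h : ⁅A, T r⁆ ∈ (freeSub f s).map (toPolyMod p (d + 1) lam).toLinearMap := by
      refine lie_mem_of_intertwine (L := soG' p (d + 1)) (lower' p (d := d)) _ ?_ T ?_ ?_ r A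
      · rintro i _ ⟨g, hg, rfl⟩
        refine ⟨X i.castSucc * g, X_mul_mem_freeSub i hg, ?_⟩
        exact congrArg (toPolyMod p (d + 1) lam) (act_lower lam i.castSucc g).symm
      · intro i g
        rw [hT, hT, hl, map_mul (rename Fin.castSucc), rename_X, mul_assoc]
        exact congrArg (toPolyMod p (d + 1) lam) (act_lower lam i.castSucc _).symm
      · intro B
        rw [hT, hl, map_one, one_mul]
        exact ⟨_, hy B, rfl⟩
    obtain ⟨g, hg, hge⟩ := h
    rw [hT, hl] at hge
    rwa [← (toPolyMod p (d + 1) lam).injective hge]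

/-- Leading polynomials of all degrees form a basis over `ℂ[y_1, …, y_d]`. -/
noncomputable def leadingBasis (hf : ∀ b, IsLeading p b (f b)) :
    Module.Basis ℕ (MvPolynomial (Fin d) ℂ) (Polynomial (MvPolynomial (Fin d) ℂ)) :=
  Polynomial.Sequence.basis ⟨fun b => lastEquiv d (f b), fun b => (hf b).degree_eq⟩
    (fun b => by
      have : (lastEquiv d (f b)).leadingCoeff = 1 := (hf b).monic
      change IsUnit (lastEquiv d (f b)).leadingCoeff
      rw [this]; exact isUnit_one)

theorem leadingBasis_apply (hf : ∀ b, IsLeading p b (f b)) (b : ℕ) :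
    leadingBasis hf b = lastEquiv d (f b) :=
  Polynomial.Sequence.basis_eq_self _ _ b

theorem disjoint_freeSub (hf : ∀ b, IsLeading p b (f b)) {s t : Set ℕ} (h : Disjoint s t) :
    Disjoint (freeSub f s) (freeSub f t) := by
  rw [Submodule.disjoint_def]
  intro x hs ht
  have hli := (leadingBasis hf).linearIndependent.disjoint_span_image h
  have he : (⇑(leadingBasis hf) : ℕ → _) = fun b => lastEquiv d (f b) :=
    funext (leadingBasis_apply hf)
  rw [he, Submodule.disjoint_def] at hli
  exact (lastEquiv d).map_eq_zero_iff.mp (hli _ hs ht)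

theorem freeSub_union {κ : Type*} (t : κ → Set ℕ) :
    freeSub f (⋃ c, t c) = ⨆ c, freeSub f (t c) := by
  refine le_antisymm ?_ (iSup_le fun c => freeSub_mono (Set.subset_iUnion t c))
  intro x hx
  obtain ⟨y, rfl⟩ := (lastEquiv d).symm.surjective x
  rw [mem_freeSub, AlgEquiv.apply_symm_apply, Set.image_iUnion, Submodule.span_iUnion] at hx
  induction hx using Submodule.iSup_induction' with
  | mem c y hy =>
    refine Submodule.mem_iSup_of_mem c ?_
    rw [mem_freeSub, AlgEquiv.apply_symm_apply]; exact hy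
  | zero => rw [map_zero]; exact Submodule.zero_mem _
  | add y z _ _ hy hz => rw [map_add]; exact Submodule.add_mem _ hy hz

theorem freeSub_univ (hf : ∀ b, IsLeading p b (f b)) : freeSub f Set.univ = ⊤ := by
  refine eq_top_iff.mpr fun x _ => ?_
  rw [mem_freeSub, Set.image_univ]
  have he : (⇑(leadingBasis hf) : ℕ → _) = fun b => lastEquiv d (f b) :=
    funext (leadingBasis_apply hf)
  rw [← he, (leadingBasis hf).span_eq]
  trivial

theorem iSupIndep_freeSub (hf : ∀ b, IsLeading p b (f b)) {κ : Type*} (t : κ → Set ℕ)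
    (ht : Pairwise (Function.onFun Disjoint t)) : iSupIndep fun c => freeSub f (t c) := by
  intro c
  have h : ⨆ (j) (_ : j ≠ c), freeSub f (t j) ≤ freeSub f (⋃ (j) (_ : j ≠ c), t j) :=
    iSup₂_le fun j hj => freeSub_mono (Set.subset_iUnion₂_of_subset j hj subset_rfl)
  refine (disjoint_freeSub hf ?_).mono_right h
  simp only [Set.disjoint_iUnion_right]
  exact fun j hj => ht (Ne.symm hj)

/-- A partition of the degrees partitions the basis of leading polynomials, hence decomposes the
module as a direct sum. -/
theorem isInternal_freeSub_map {V : Type*} [AddCommGroup V] [Module ℂ V]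
    (hf : ∀ b, IsLeading p b (f b)) (Φ : MvPolynomial (Fin (d + 1)) ℂ ≃ₗ[ℂ] V)
    {κ : Type*} [DecidableEq κ] (t : κ → Set ℕ)
    (ht : Pairwise (Function.onFun Disjoint t)) (htu : ⋃ c, t c = Set.univ) :
    DirectSum.IsInternal fun c => (freeSub f (t c)).map Φ.toLinearMap := by
  rw [DirectSum.isInternal_submodule_iff_iSupIndep_and_iSup_eq_top]
  constructor
  · exact (iSupIndep_map_orderIso_iff (Submodule.orderIsoMapComap Φ)).mpr
      (iSupIndep_freeSub hf t ht)
  · rw [← Submodule.map_iSup, ← freeSub_union, htu, freeSub_univ hf]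
    rw [Submodule.map_top, LinearEquiv.range]

end Conformal

/-! ### Branching to `𝔤'` -/

/-- The same map is described twice: `D` is visibly compatible with `L`, and `E` is visibly
bijective. -/
theorem nonempty_lieModuleEquiv_directSum {L V : Type*} [LieRing L] [LieAlgebra ℂ L]
    [AddCommGroup V] [Module ℂ V] [LieRingModule L V] [LieModule ℂ L V] {ι : Type*} [DecidableEq ι]
    (M : ι → Type*) [∀ i, AddCommGroup (M i)] [∀ i, Module ℂ (M i)] [∀ i, LieRingModule L (M i)]
    [∀ i, LieModule ℂ L (M i)] (N : ι → LieSubmodule ℂ L V) (e : ∀ i, M i ≃ₗ⁅ℂ, L⁆ N i)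
    (h : DirectSum.IsInternal fun i => (N i).toSubmodule) :
    Nonempty (V ≃ₗ⁅ℂ, L⁆ ⨁ i, M i) := by
  let D : (⨁ i, M i) →ₗ[ℂ] V :=
    DirectSum.toModule ℂ ι V fun i => (N i).toSubmodule.subtype ∘ₗ (e i : M i →ₗ[ℂ] N i)
  have hD : ∀ i m, D (DirectSum.of M i m) = (e i m : V) := fun i m =>
    DirectSum.toModule_lof ℂ i m
  have hlie : ∀ (A : L) x, D ⁅A, x⁆ = ⁅A, D x⁆ := by
    intro A x
    induction x using DirectSum.induction_on with
    | zero => simp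
    | of i m =>
      have h1 : ⁅A, DirectSum.of M i m⁆ = DirectSum.of M i ⁅A, m⁆ :=
        (LieModuleHom.map_lie (DirectSum.lieModuleOf ℂ ι L M i) A m).symm
      rw [h1, hD, hD]
      exact congrArg Subtype.val (LieModuleHom.map_lie (e i).toLieModuleHom A m)
    | add x y hx hy => rw [lie_add, map_add, hx, hy, map_add, lie_add]
  let E : (⨁ i, M i) ≃ₗ[ℂ] V :=
    (DFinsupp.mapRange.linearEquiv fun i => (e i).toLinearEquiv).trans
      (LinearEquiv.ofBijective (DirectSum.coeLinearMap fun i => (N i).toSubmodule) h)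
  have hDE : ∀ x, D x = E x := by
    intro x
    induction x using DirectSum.induction_on with
    | zero => simp
    | of i m =>
      rw [hD]
      change _ = DirectSum.coeLinearMap (fun i => (N i).toSubmodule)
        (DFinsupp.mapRange.linearEquiv (fun i => (e i).toLinearEquiv) (DFinsupp.single i m))
      rw [DFinsupp.mapRange.linearEquiv_apply, DFinsupp.mapRange_single]
      exact (DirectSum.coeLinearMap_lof (fun i => (N i).toSubmodule) i (e i m)).symm
    | add x y hx hy => rw [map_add, map_add, hx, hy]
  let E' : (⨁ i, M i) ≃ₗ⁅ℂ, L⁆ V :=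
    { E with
      map_lie' := by
        intro A x
        change E ⁅A, x⁆ = ⁅A, E x⁆
        rw [← hDE, ← hDE, hlie] }
  exact ⟨E'.symm⟩

/-- A quotient of a module which is free over `ℂ[Y]` on an eigenvector of `P` is a generalized Verma
module. -/
theorem GenVerma.exists_quotient_map {L ι : Type*} [LieRing L] [LieAlgebra ℂ L]
    {P : LieSubalgebra ℂ L} {ρ : P →ₗ⁅ℂ⁆ Module.End ℂ ℂ} {N : Type*} [AddCommGroup N] [Module ℂ N]
    [LieRingModule L N] [LieModule ℂ L N] (Y : ι → L) (hY : ∀ i j, ⁅Y i, Y j⁆ = 0)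
    (hspan : ∀ x : L, ∃ y ∈ Submodule.span ℂ (Set.range Y), x - y ∈ P) (K : LieSubmodule ℂ L N)
    (T : MvPolynomial ι ℂ →ₗ[ℂ] N) (hT : ∀ i f, T (MvPolynomial.X i * f) = ⁅Y i, T f⁆)
    (hv : ∀ A : P, ⁅(A : L), T 1⁆ - ρ A 1 • T 1 ∈ K) (hinj : ∀ r, T r ∈ K → r = 0)
    (hsurj : ∀ y, ∃ r, T r - y ∈ K) :
    ∃ g : N →ₗ⁅ℂ, L⁆ GenVerma P ρ, Function.Surjective g ∧ (∀ x, g x = 0 ↔ x ∈ K) ∧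
      g (T 1) = gen P ρ := by
  let q : N →ₗ⁅ℂ, L⁆ N ⧸ K := LieSubmodule.Quotient.mk' K
  have hq : ∀ x : N, q x = 0 ↔ x ∈ K := fun x => LieSubmodule.Quotient.mk_eq_zero (N := K)
  have hqs : Function.Surjective q := LieSubmodule.Quotient.surjective_mk' K
  obtain ⟨e, he⟩ := GenVerma.exists_equiv (P := P) (ρ := ρ) Y hY hspan
    ((q : N →ₗ[ℂ] N ⧸ K) ∘ₗ T)
    (fun i f => by
      change q _ = ⁅Y i, q (T f)⁆
      rw [hT, LieModuleHom.map_lie])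
    (fun A => by
      change ⁅(A : L), q (T 1)⁆ = ρ A 1 • q (T 1)
      rw [← LieModuleHom.map_lie, ← map_smul, ← sub_eq_zero, ← map_sub, hq]
      exact hv A)
    (by
      constructor
      · rw [← LinearMap.ker_eq_bot, LinearMap.ker_eq_bot']
        intro r h
        exact hinj r ((hq _).mp h)
      · intro y
        obtain ⟨x, rfl⟩ := hqs y
        obtain ⟨r, hr⟩ := hsurj x
        refine ⟨r, ?_⟩
        change q (T r) = q x
        rw [← sub_eq_zero, ← map_sub, hq]
        exact hr)
  refine ⟨e.symm.toLieModuleHom.comp q, e.symm.surjective.comp hqs, fun x => ?_, ?_⟩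
  · rw [← hq]
    exact e.symm.toLinearEquiv.map_eq_zero_iff
  · change e.symm (q (T 1)) = _
    rw [show q (T 1) = e (gen P ρ) from he.symm]
    exact e.symm_apply_apply _

/-- Reduces non-splitness to a statement about vectors: a section sends the generator to a genuine
`P`-eigenvector lifting it. -/
theorem GenVerma.exists_of_section {L : Type*} [LieRing L] [LieAlgebra ℂ L]
    {P : LieSubalgebra ℂ L} {ρ : P →ₗ⁅ℂ⁆ Module.End ℂ ℂ} {N : Type*} [AddCommGroup N] [Module ℂ N]
    [LieRingModule L N] [LieModule ℂ L N] {g : N →ₗ⁅ℂ, L⁆ GenVerma P ρ}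
    {σ : GenVerma P ρ →ₗ⁅ℂ, L⁆ N} (hσ : ∀ c, g (σ c) = c) {v : N} (hv : g v = gen P ρ) :
    ∃ w, g (w - v) = 0 ∧ ∀ A : P, ⁅(A : L), w⁆ = ρ A 1 • w := by
  refine ⟨σ (gen P ρ), by rw [map_sub, hσ, hv, sub_self], fun A => ?_⟩
  rw [← LieModuleHom.map_lie, lie_gen, map_smul]

namespace Conformal

open MvPolynomial

variable {p d : ℕ} {V : Type*} [AddCommGroup V] [Module ℂ V] [LieRingModule (soG' p (d + 1)) V]
  [LieModule ℂ (soG' p (d + 1)) V] {lam : ℂ} {f : ℕ → MvPolynomial (Fin (d + 1)) ℂ}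

theorem mem_freeSub_singleton {a : ℕ} {x : MvPolynomial (Fin (d + 1)) ℂ} :
    x ∈ freeSub f {a} ↔ ∃ r, rename Fin.castSucc r * f a = x := by
  rw [mem_freeSub, Set.image_singleton, Submodule.mem_span_singleton]
  refine exists_congr fun r => ?_
  rw [← lastEquiv_rename_mul, (lastEquiv d).injective.eq_iff]

theorem mem_freeSub_pair {a b : ℕ} {x : MvPolynomial (Fin (d + 1)) ℂ} :
    x ∈ freeSub f {a, b} ↔
      ∃ r u, rename Fin.castSucc r * f a + rename Fin.castSucc u * f b = x := by
  rw [mem_freeSub, Set.image_pair, Submodule.mem_span_pair]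
  refine exists_congr fun r => exists_congr fun u => ?_
  rw [← lastEquiv_rename_mul, ← lastEquiv_rename_mul, ← map_add, (lastEquiv d).injective.eq_iff]

/-- The `𝔤'`-submodule carried by `freeSub f s`. -/
noncomputable def freeLieSub (Φ : MvPolynomial (Fin (d + 1)) ℂ ≃ₗ[ℂ] V)
    (hΦ : ∀ (A : soG' p (d + 1)) x, ⁅A, Φ x⁆ = Φ (act p lam A.1.1 x)) (s : Set ℕ)
    (hf : ∀ b ∈ s, IsLeading p b (f b))
    (hr : ∀ b ∈ s, ∀ j : Fin d, raise p lam j.castSucc (f b) ∈ freeSub f s) :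
    LieSubmodule ℂ (soG' p (d + 1)) V where
  toSubmodule := (freeSub f s).map Φ.toLinearMap
  lie_mem := by
    rintro A _ ⟨x, hx, rfl⟩
    exact ⟨_, act_mem_freeSub hf hr A hx, (hΦ A x).symm⟩

theorem rename_mul_injective {F : MvPolynomial (Fin (d + 1)) ℂ} (hF : F ≠ 0)
    {r u : MvPolynomial (Fin d) ℂ} (h : rename Fin.castSucc r * F = rename Fin.castSucc u * F) :
    r = u :=
  rename_injective _ (Fin.castSucc_injective d) (mul_right_cancel₀ hF h)

theorem charG'_apply_one (mu : ℂ) (A : parG' p (d + 1)) :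
    charG' p (d + 1) mu A 1 = mu * A.1.1.1 0 0 := by
  change mu * A.1.1.1 0 0 * 1 = _
  rw [mul_one]

theorem IsLeading.act_parG' {N : ℕ} {F : MvPolynomial (Fin (d + 1)) ℂ} (h : IsLeading p N F)
    (lam : ℂ) (A : parG' p (d + 1)) : act p lam A.1.1.1 F =
      C ((lam - N) * A.1.1.1 0 0) * F +
        ∑ j : Fin d, C (A.1.1.1 0 (mid j.castSucc)) * raise p lam j.castSucc F := by
  rw [h.act_eq, Finset.sum_eq_zero, zero_add]
  intro i _
  have : A.1.1.1 (mid i.castSucc) 0 = 0 := A.2 _ (mid_ne_zero _)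
  rw [this, C_0, zero_mul]

/-- The `𝔤'`-module generated by a singular vector. -/
theorem nonempty_equiv_freeLieSub_singleton (Φ : MvPolynomial (Fin (d + 1)) ℂ ≃ₗ[ℂ] V)
    (hΦ : ∀ (A : soG' p (d + 1)) x, ⁅A, Φ x⁆ = Φ (act p lam A.1.1 x)) (b : ℕ)
    (hf : ∀ c ∈ ({b} : Set ℕ), IsLeading p c (f c))
    (hr : ∀ c ∈ ({b} : Set ℕ), ∀ j : Fin d, raise p lam j.castSucc (f c) ∈ freeSub f {b})
    (h0 : ∀ j : Fin d, raise p lam j.castSucc (f b) = 0) :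
    Nonempty (VermaG' p (d + 1) (lam - b) ≃ₗ⁅ℂ, soG' p (d + 1)⁆ freeLieSub Φ hΦ {b} hf hr) := by
  have hb : IsLeading p b (f b) := hf b rfl
  let ψ₀ : MvPolynomial (Fin d) ℂ →ₗ[ℂ] V :=
    Φ.toLinearMap ∘ₗ LinearMap.mulRight ℂ (f b) ∘ₗ (rename Fin.castSucc).toLinearMap
  have hψ₀ : ∀ r, ψ₀ r = Φ (rename Fin.castSucc r * f b) := fun r => rfl
  let ψ : MvPolynomial (Fin d) ℂ →ₗ[ℂ] freeLieSub Φ hΦ {b} hf hr :=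
    ψ₀.codRestrict _ fun r => ⟨_, mem_freeSub_singleton.mpr ⟨r, rfl⟩, rfl⟩
  have hψ : ∀ r, (ψ r : V) = Φ (rename Fin.castSucc r * f b) := fun r => rfl
  obtain ⟨e, -⟩ := GenVerma.exists_equiv (P := parG' p (d + 1)) (ρ := charG' p (d + 1) (lam - b))
    (lower' p (d := d)) lie_lower'_lower' exists_span_lower'_sub_mem ψ
    (fun i r => by
      apply Subtype.ext
      rw [LieSubmodule.coe_bracket, hψ, hψ, hΦ, map_mul (rename Fin.castSucc), rename_X, mul_assoc]
      exact congrArg Φ (act_lower lam i.castSucc _).symm)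
    (fun A => by
      apply Subtype.ext
      rw [LieSubmodule.coe_bracket, LieSubmodule.coe_smul, hψ, hΦ, map_one, one_mul,
        charG'_apply_one, hb.act_parG', ← map_smul, smul_eq_C_mul]
      simp [h0])
    (by
      constructor
      · intro r u h
        have h1 := congrArg Subtype.val h
        rw [hψ, hψ] at h1
        exact rename_mul_injective hb.ne_zero (Φ.injective h1)
      · rintro ⟨_, x, hx, rfl⟩
        obtain ⟨r, rfl⟩ := mem_freeSub_singleton.mp hx
        exact ⟨r, rfl⟩)
  exact ⟨e⟩

/-- A rotation invariant vector of degree `N` killed by the raising operators is killed by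
`singOp`. -/
theorem singOp_eq_zero_of_parG' (hd : 0 < d) {N : ℕ} {x : MvPolynomial (Fin (d + 1)) ℂ}
    (h : ∀ A : parG' p (d + 1), act p lam A.1.1.1 x = C ((lam - N) * A.1.1.1 0 0) * x) :
    RotInv p x ∧ euler (d + 1) x = C (N : ℂ) * x ∧ singOp p lam N x = 0 := by
  -- Evaluate on elements of 𝔭': rotations have `A₀₀ = 0` and give invariance, the grading element
  -- gives the degree, and a single raising element already gives `singOp`.
  have h1 : RotInv p x := by
    intro i j
    have := h ⟨rotElt p i j, rotElt_mem i j⟩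
    rw [act_rotElt, rotElt_val] at this
    simp only [Matrix.sub_apply, Matrix.single_apply, mid_ne_zero, false_and, if_false, sub_zero,
      mul_zero, C_0, zero_mul] at this
    exact sub_eq_zero.mp this
  have h2 : euler (d + 1) x = C (N : ℂ) * x := by
    have h2 : Fin.last (d + 2) ≠ 0 := by simp [Fin.ext_iff]
    have := h ⟨gradingElt p d, gradingElt_mem⟩
    rw [act_gradingElt, gradingElt_val] at this
    simp only [Matrix.sub_apply, Matrix.single_apply, h2, if_false, sub_zero, and_self,
      if_true, mul_one, C_sub] at this
    linear_combination - this
  refine ⟨h1, h2, ?_⟩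
  have h3 := h ⟨raiseElt p ⟨0, hd⟩, raiseElt_mem _⟩
  rw [act_raiseElt, raiseElt_val] at h3
  simp only [Matrix.sub_apply, Matrix.single_apply, mid_ne_zero, false_and, if_false, sub_zero,
    and_false, mul_zero, C_0, zero_mul] at h3
  have h4 := h1.quad_mul_raise (lam := lam) h2 ⟨0, hd⟩
  rw [h3, mul_zero] at h4
  exact (mul_eq_zero.mp h4.symm).resolve_left
    (mul_ne_zero (C_ne_zero.mpr (eps_ne_zero _)) (X_ne_zero _))

set_option maxHeartbeats 1000000 in
/-- In the resonant case, the module generated by a pair of leading polynomials of degrees `a` and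
`2 l + a` is a non-split extension. -/
theorem exists_isNonSplitExact (hd : 0 < d) (Φ : MvPolynomial (Fin (d + 1)) ℂ ≃ₗ[ℂ] V)
    (hΦ : ∀ (A : soG' p (d + 1)) x, ⁅A, Φ x⁆ = Φ (act p lam A.1.1 x)) (a l : ℕ) (hl : 1 ≤ l)
    (hlam : 2 * lam = 2 * (a + l : ℕ) - (d : ℂ))
    (hf : ∀ b ∈ ({a, 2 * l + a} : Set ℕ), IsLeading p b (f b))
    (hr : ∀ b ∈ ({a, 2 * l + a} : Set ℕ), ∀ j : Fin d,
      raise p lam j.castSucc (f b) ∈ freeSub f {a, 2 * l + a})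
    (hs : singOp p lam a (f a) = 0) {κ : ℂ} (hκ : κ ≠ 0)
    (hG : singOp p lam (2 * l + a : ℕ) (f (2 * l + a)) = C κ * quad p d ^ l * f a)
    {mu : ℂ} (hmu : mu = lam - (2 * l + a : ℕ)) :
    ∃ (i : VermaG' p (d + 1) (lam - a) →ₗ⁅ℂ, soG' p (d + 1)⁆
        freeLieSub Φ hΦ {a, 2 * l + a} hf hr)
      (g : freeLieSub Φ hΦ {a, 2 * l + a} hf hr →ₗ⁅ℂ, soG' p (d + 1)⁆
        VermaG' p (d + 1) mu), IsNonSplitExact i g := by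
  subst hmu
  have ha : IsLeading p a (f a) := hf a (Or.inl rfl)
  have hb : IsLeading p (2 * l + a) (f (2 * l + a)) := hf _ (Or.inr rfl)
  set b := 2 * l + a with hbdef
  have hra : ∀ j : Fin d, raise p lam j.castSucc (f a) = 0 := ha.raise_eq_zero hs
  have hrb : ∀ j : Fin d, raise p lam j.castSucc (f b) ∈ freeSub f {a} := by
    intro j
    rw [raise_eq_of_singOp hb hl hG j, mul_assoc, mul_assoc, mul_assoc]
    exact C_mul_mem_freeSub _ (X_mul_mem_freeSub _ (C_mul_mem_freeSub _
      (quad_mul_mem_freeSub _ (self_mem_freeSub rfl))))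
  have hfa : ∀ c ∈ ({a} : Set ℕ), IsLeading p c (f c) := by rintro _ rfl; exact ha
  have hraa : ∀ c ∈ ({a} : Set ℕ), ∀ j : Fin d, raise p lam j.castSucc (f c) ∈ freeSub f {a} := by
    rintro _ rfl j; rw [hra]; exact Submodule.zero_mem _
  let N := freeLieSub Φ hΦ {a, b} hf hr
  let Na := freeLieSub Φ hΦ {a} hfa hraa
  have hNa : Na ≤ N := Submodule.map_mono (freeSub_mono (Set.singleton_subset_iff.mpr (Or.inl rfl)))
  have hmemNa : ∀ x, Φ x ∈ Na ↔ x ∈ freeSub f {a} := fun x =>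
    ⟨fun ⟨y, hy, hyx⟩ => Φ.injective hyx ▸ hy, fun hx => ⟨x, hx, rfl⟩⟩
  let K : LieSubmodule ℂ (soG' p (d + 1)) N := Na.comap N.incl
  have hK : ∀ x : N, x ∈ K ↔ (x : V) ∈ Na := fun x => LieSubmodule.mem_comap
  let ψ₀ : MvPolynomial (Fin d) ℂ →ₗ[ℂ] V :=
    Φ.toLinearMap ∘ₗ LinearMap.mulRight ℂ (f b) ∘ₗ (rename Fin.castSucc).toLinearMap
  obtain ⟨ψ₁, hψ₁⟩ : ∃ ψ₁ : MvPolynomial (Fin d) ℂ →ₗ[ℂ] N,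
      ∀ r, (ψ₁ r : V) = Φ (rename Fin.castSucc r * f b) :=
    ⟨ψ₀.codRestrict N.toSubmodule fun r =>
      ⟨_, mem_freeSub_pair.mpr ⟨0, r, rfl⟩, by simp [ψ₀]⟩, fun r => rfl⟩
  -- Compare degrees in `t`: nonzero multiples of `f b` have degree `b`, those of `f a` have degree
  -- `a`, and `a < b`.
  have hdisj : ∀ r, rename Fin.castSucc r * f b ∈ freeSub f {a} → r = 0 := by
    intro r hx
    obtain ⟨u, hu⟩ := mem_freeSub_singleton.mp hx
    by_contra h0
    have h1 := congrArg (fun y => (lastEquiv d y).degree) hu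
    simp only [lastEquiv_rename_mul, Polynomial.smul_eq_C_mul, Polynomial.degree_mul, ha.degree_eq,
      hb.degree_eq, Polynomial.degree_C h0, zero_add] at h1
    by_cases hu0 : u = 0
    · rw [hu0] at h1
      simp at h1
    · rw [Polynomial.degree_C hu0, zero_add] at h1
      have : a = b := Nat.cast_injective h1
      omega
  -- Modulo the submodule generated by `f a`, the images of `f b` under the raising operators
  -- vanish, so `f b` becomes singular there.
  obtain ⟨g, hgs, hgK, hg1⟩ := GenVerma.exists_quotient_map (P := parG' p (d + 1))
    (ρ := charG' p (d + 1) (lam - b)) (lower' p (d := d)) lie_lower'_lower'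
    exists_span_lower'_sub_mem K ψ₁
    (fun i r => by
      apply Subtype.ext
      rw [LieSubmodule.coe_bracket, hψ₁, hψ₁, hΦ, map_mul (rename Fin.castSucc), rename_X, mul_assoc]
      exact congrArg Φ (act_lower lam i.castSucc _).symm)
    (fun A => by
      rw [hK, LieSubmodule.coe_sub, LieSubmodule.coe_bracket, LieSubmodule.coe_smul, hψ₁, hΦ,
        map_one, one_mul, charG'_apply_one, hb.act_parG', ← map_smul, smul_eq_C_mul, ← map_sub,
        add_sub_cancel_left, hmemNa]
      exact Submodule.sum_mem _ fun j _ => C_mul_mem_freeSub _ (hrb j))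
    (fun r h => by
      rw [hK, hψ₁, hmemNa] at h
      exact hdisj r h)
    (fun y => by
      obtain ⟨_, x, hx, rfl⟩ := y
      obtain ⟨r, u, rfl⟩ := mem_freeSub_pair.mp hx
      refine ⟨u, ?_⟩
      rw [hK, LieSubmodule.coe_sub, hψ₁]
      change Φ _ - Φ _ ∈ Na
      rw [← map_sub, hmemNa, sub_add_cancel_right]
      exact Submodule.neg_mem _ (rename_mul_mem_freeSub _ (self_mem_freeSub rfl)))
  obtain ⟨e₁⟩ := nonempty_equiv_freeLieSub_singleton Φ hΦ a hfa hraa hra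
  let i : VermaG' p (d + 1) (lam - a) →ₗ⁅ℂ, soG' p (d + 1)⁆ N :=
    (LieSubmodule.inclusion hNa).comp e₁.toLieModuleHom
  have hi : ∀ m, (i m : V) = (e₁ m : V) := fun m => rfl
  have hg0 : ∀ x, g x = 0 ↔ (x : V) ∈ Na := fun x => (hgK x).trans (hK x)
  refine ⟨i, g, ⟨?_, ?_, ?_, ?_⟩⟩
  · intro m m' h
    have h1 := congrArg Subtype.val h
    rw [hi, hi] at h1
    exact e₁.injective (Subtype.ext h1)
  · exact hgs
  · intro x
    rw [hg0]
    constructor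
    · intro hx
      obtain ⟨m, hm⟩ := e₁.surjective ⟨x, hx⟩
      exact ⟨m, Subtype.ext (by rw [hi, hm])⟩
    · rintro ⟨m, rfl⟩
      rw [hi]
      exact (e₁ m).2
  -- A section would give a singular vector `x = r f_a + f_b`. Homogeneity fixes the degree of `r
  -- f_a`, so `singOp` kills that part and leaves `κ s^l f_a`, which is nonzero.
  · rintro ⟨σ, hσ⟩
    obtain ⟨v, h1, h2⟩ := GenVerma.exists_of_section hσ hg1
    obtain ⟨x, hx⟩ := Φ.surjective (v : V)
    have hgx : x - f b ∈ freeSub f {a} := by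
      have h3 : (v : V) - (ψ₁ 1 : V) ∈ Na := (hg0 _).mp h1
      have h4 : (ψ₁ 1 : V) = Φ (f b) := by rw [hψ₁, map_one, one_mul]
      rw [h4, ← hx, ← map_sub Φ, hmemNa] at h3
      exact h3
    obtain ⟨r, hrw⟩ := mem_freeSub_singleton.mp hgx
    have hact : ∀ A : parG' p (d + 1), act p lam A.1.1.1 x = C ((lam - b) * A.1.1.1 0 0) * x := by
      intro A
      apply Φ.injective
      rw [← hΦ, hx, ← smul_eq_C_mul, map_smul, hx, ← LieSubmodule.coe_bracket, h2,
        charG'_apply_one, LieSubmodule.coe_smul]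
    obtain ⟨hx1, hx2, hx3⟩ := singOp_eq_zero_of_parG' hd hact
    have hw : euler (d + 1) (rename Fin.castSucc r * f a) =
        C (b : ℂ) * (rename Fin.castSucc r * f a) := by
      rw [hrw, map_sub, hx2, hb.euler_eq]; ring
    have h2 := singOp_rename_mul ha hs hlam r hw
    have h3 : x = rename Fin.castSucc r * f a + f b := by rw [hrw]; ring
    rw [h3, singOp_add, h2, hG, zero_add] at hx3
    exact mul_ne_zero (mul_ne_zero (C_ne_zero.mpr hκ) (pow_ne_zero _ (quad_ne_zero hd))) ha.ne_zero
      hx3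

end Conformal

/-! ### The two branching laws -/

namespace Conformal

open MvPolynomial

theorem two_mul_excParam (d j : ℕ) : 2 * excParam (d + 1) j = j - (d : ℂ) := by
  unfold excParam; push_cast; ring

/-- `M_𝔭^𝔤(lam)` is realised on polynomials, as a `𝔤'`-module. -/
theorem exists_poly_equiv (p d : ℕ) (lam : ℂ) :
    ∃ Φ : MvPolynomial (Fin (d + 1)) ℂ ≃ₗ[ℂ] VermaG p (d + 1) lam,
      ∀ (A : soG' p (d + 1)) x, ⁅A, Φ x⁆ = Φ (act p lam A.1.1 x) := by
  obtain ⟨e⟩ := exists_vermaG_equiv p (d + 1) lam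
  refine ⟨(toPolyMod p (d + 1) lam).trans e.symm.toLinearEquiv, fun A x => ?_⟩
  exact (LieModuleHom.map_lie e.symm.toLieModuleHom A.1 (toPolyMod p (d + 1) lam x)).symm

theorem branching_odd (p d : ℕ) (k : ℕ) :
    Nonempty (VermaG p (d + 1) (excParam (d + 1) (2 * k + 1)) ≃ₗ⁅ℂ, soG' p (d + 1)⁆
      ⨁ b : ℕ, VermaG' p (d + 1) (excParam (d + 1) (2 * k + 1) - b)) := by
  obtain ⟨Φ, hΦ⟩ := exists_poly_equiv p d (excParam (d + 1) (2 * k + 1))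
  have h : ∀ N : ℕ, ∃ F : MvPolynomial (Fin (d + 1)) ℂ, IsLeading p N F ∧
      singOp p (excParam (d + 1) (2 * k + 1)) N F = 0 := by
    intro N
    refine exists_singular p d N _ fun m _ => ?_
    rw [two_mul_excParam]
    intro h
    -- A resonance would equate an odd and an even integer.
    have h1 : ((2 * (m + 1) + (2 * k + 1) : ℕ) : ℂ) = ((2 * N : ℕ) : ℂ) := by
      push_cast at h ⊢; linear_combination h
    have h2 := Nat.cast_injective h1
    omega
  choose f hf hs using h
  have hr : ∀ b, ∀ c ∈ ({b} : Set ℕ), ∀ j : Fin d,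
      raise p (excParam (d + 1) (2 * k + 1)) j.castSucc (f c) ∈ freeSub f {b} := by
    intro b c _ j
    rw [(hf c).raise_eq_zero (hs c)]
    exact Submodule.zero_mem _
  refine nonempty_lieModuleEquiv_directSum _
    (fun b => freeLieSub Φ hΦ {b} (fun c _ => hf c) (hr b))
    (fun b => (nonempty_equiv_freeLieSub_singleton Φ hΦ b (fun c _ => hf c) (hr b)
      ((hf b).raise_eq_zero (hs b))).some) ?_
  refine isInternal_freeSub_map hf Φ (fun b => {b}) (fun a b hab => ?_)
    (Set.iUnion_of_singleton ℕ)
  exact Set.disjoint_singleton.mpr hab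

/-- Resonance means `m + 1 = b - k` with `m < b / 2`, that is `k < b ≤ 2k`. The reflection `b ↦ 2k -
b` pairs these degrees with `0, …, k - 1`; its fixed point `k` and the degrees above `2k` remain
single. -/
theorem branching_even (p d : ℕ) (hd : 0 < d) (k : ℕ) :
    ∃ (M : Fin k → LieSubmodule ℂ (soG' p (d + 1)) (VermaG p (d + 1) (excParam (d + 1) (2 * k))))
      (A : LieSubmodule ℂ (soG' p (d + 1)) (VermaG p (d + 1) (excParam (d + 1) (2 * k))))
      (B : {b : ℕ // 2 * k + 1 ≤ b} → LieSubmodule ℂ (soG' p (d + 1))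
          (VermaG p (d + 1) (excParam (d + 1) (2 * k)))),
      DirectSum.IsInternal
        (Sum.elim (fun a => (M a).toSubmodule)
          (Sum.elim (fun _ : Unit => A.toSubmodule) (fun b => (B b).toSubmodule))) ∧
      (∀ a : Fin k,
        ∃ (f : VermaG' p (d + 1) (excParam (d + 1) (2 * k) - (a : ℕ))
              →ₗ⁅ℂ, soG' p (d + 1)⁆ M a)
          (g : M a →ₗ⁅ℂ, soG' p (d + 1)⁆
              VermaG' p (d + 1) (excParam (d + 1) (2 * k) - (2 * (k : ℂ) - (a : ℕ)))),
          IsNonSplitExact f g) ∧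
      Nonempty (A ≃ₗ⁅ℂ, soG' p (d + 1)⁆ VermaG' p (d + 1) (excParam (d + 1) (2 * k) - k)) ∧
      (∀ b, Nonempty (B b ≃ₗ⁅ℂ, soG' p (d + 1)⁆
        VermaG' p (d + 1) (excParam (d + 1) (2 * k) - (b : ℕ)))) := by
  obtain ⟨Φ, hΦ⟩ := exists_poly_equiv p d (excParam (d + 1) (2 * k))
  have hlam := two_mul_excParam d (2 * k)
  generalize excParam (d + 1) (2 * k) = lam at Φ hΦ hlam ⊢
  have hpair : ∀ a, a < k → ∃ (F G : MvPolynomial (Fin (d + 1)) ℂ) (κ : ℂ), κ ≠ 0 ∧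
      IsLeading p a F ∧ singOp p lam a F = 0 ∧ IsLeading p (2 * (k - a) + a) G ∧
      singOp p lam (2 * (k - a) + a : ℕ) G = C κ * quad p d ^ (k - a) * F := by
    intro a ha
    refine exists_singular_pair p d a (k - a) (by omega) lam ?_
    rw [hlam, Nat.add_sub_cancel' ha.le]; push_cast; ring
  have hsingle : ∀ b, b = k ∨ 2 * k + 1 ≤ b → ∃ F : MvPolynomial (Fin (d + 1)) ℂ,
      IsLeading p b F ∧ singOp p lam b F = 0 := by
    intro b hb
    refine exists_singular p d b _ fun m hm => ?_
    rw [add_sub_assoc, hlam]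
    intro h
    have h1 : ((2 * (m + 1) + 2 * k : ℕ) : ℂ) = ((2 * b : ℕ) : ℂ) := by
      push_cast at h ⊢; linear_combination h
    have h2 := Nat.cast_injective h1
    omega
  choose! F G κ hκ hF hFs hG hGs using hpair
  choose! H hH hHs using hsingle
  -- One family indexed by degree; `G` is indexed by the lower degree `a` of its pair, hence the
  -- argument `2 * k - b`.
  let f : ℕ → MvPolynomial (Fin (d + 1)) ℂ := fun b =>
    if b < k then F b else if b = k then H b else if b ≤ 2 * k then G (2 * k - b) else H b
  have f1 : ∀ a < k, f a = F a := fun a ha => if_pos ha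
  have f2 : ∀ a < k, f (2 * (k - a) + a) = G a := by
    intro a ha
    simp only [f]
    rw [if_neg (by omega), if_neg (by omega), if_pos (by omega)]
    congr 1; omega
  have f3 : ∀ b, b = k ∨ 2 * k + 1 ≤ b → f b = H b := by
    intro b hb
    simp only [f]
    rw [if_neg (by omega)]
    rcases hb with rfl | hb
    · rw [if_pos rfl]
    · rw [if_neg (by omega), if_neg (by omega)]
  have hcases : ∀ b, b < k ∨ (∃ a < k, b = 2 * (k - a) + a) ∨ (b = k ∨ 2 * k + 1 ≤ b) := by
    intro b
    by_cases h1 : b < k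
    · exact Or.inl h1
    · by_cases h2 : k < b ∧ b ≤ 2 * k
      · exact Or.inr (Or.inl ⟨2 * k - b, by omega, by omega⟩)
      · exact Or.inr (Or.inr (by omega))
  have hf : ∀ b, IsLeading p b (f b) := by
    intro b
    rcases hcases b with h | ⟨a, ha, rfl⟩ | h
    · rw [f1 b h]; exact hF b h
    · rw [f2 a ha]; exact hG a ha
    · rw [f3 b h]; exact hH b h
  have hr : ∀ a : Fin k, ∀ b ∈ ({(a : ℕ), 2 * (k - a) + a} : Set ℕ), ∀ j : Fin d,
      raise p lam j.castSucc (f b) ∈ freeSub f {(a : ℕ), 2 * (k - a) + a} := by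
    rintro ⟨a, ha⟩ b (rfl | rfl) j
    · rw [f1 b ha, (hF b ha).raise_eq_zero (hFs b ha)]
      exact Submodule.zero_mem _
    · rw [f2 a ha, raise_eq_of_singOp (hG a ha) (by omega) (hGs a ha) j, ← f1 a ha, mul_assoc,
        mul_assoc, mul_assoc]
      exact C_mul_mem_freeSub _ (X_mul_mem_freeSub _ (C_mul_mem_freeSub _
        (quad_mul_mem_freeSub _ (self_mem_freeSub (Or.inl rfl)))))
  have hr0 : ∀ b, b = k ∨ 2 * k + 1 ≤ b → ∀ j : Fin d, raise p lam j.castSucc (f b) = 0 := by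
    intro b hb j
    rw [f3 b hb, (hH b hb).raise_eq_zero (hHs b hb)]
  have hr1 : ∀ b, b = k ∨ 2 * k + 1 ≤ b → ∀ c ∈ ({b} : Set ℕ), ∀ j : Fin d,
      raise p lam j.castSucc (f c) ∈ freeSub f {b} := by
    rintro b hb _ rfl j
    rw [hr0 _ hb]; exact Submodule.zero_mem _
  refine ⟨fun a => freeLieSub Φ hΦ {(a : ℕ), 2 * (k - a) + a} (fun c _ => hf c) (hr a),
    freeLieSub Φ hΦ {k} (fun c _ => hf c) (hr1 k (Or.inl rfl)),
    fun b => freeLieSub Φ hΦ {b.1} (fun c _ => hf c) (hr1 b.1 (Or.inr b.2)), ?_, ?_, ?_, ?_⟩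
  -- The degrees are partitioned into the pairs `{a, 2k - a}`, the singleton `{k}` and the
  -- singletons above `2k`.
  · let t : Fin k ⊕ Unit ⊕ {b : ℕ // 2 * k + 1 ≤ b} → Set ℕ :=
      Sum.elim (fun a => {(a : ℕ), 2 * (k - a) + a}) (Sum.elim (fun _ => {k}) (fun b => {b.1}))
    have ht : Pairwise (Function.onFun Disjoint t) := by
      intro c c' hcc
      rw [Function.onFun, Set.disjoint_left]
      intro x hx hx'
      apply hcc
      rcases c with a | _ | b <;> rcases c' with a' | _ | b' <;>
        simp only [t, Sum.elim_inl, Sum.elim_inr, Set.mem_insert_iff, Set.mem_singleton_iff]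
          at hx hx'
      · congr 1
        have := a.2
        have := a'.2
        exact Fin.ext (by omega)
      · have := a.2; omega
      · have := a.2; have := b'.2; omega
      · have := a'.2; omega
      · rfl
      · have := b'.2; omega
      · have := a'.2; have := b.2; omega
      · have := b.2; omega
      · congr 2
        exact Subtype.ext (hx.symm.trans hx')
    have htu : ⋃ c, t c = Set.univ := by
      refine Set.eq_univ_of_forall fun b => Set.mem_iUnion.mpr ?_
      rcases hcases b with h | ⟨a, ha, rfl⟩ | rfl | h
      · exact ⟨Sum.inl ⟨b, h⟩, Or.inl rfl⟩
      · exact ⟨Sum.inl ⟨a, ha⟩, Or.inr rfl⟩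
      · exact ⟨Sum.inr (Sum.inl ()), rfl⟩
      · exact ⟨Sum.inr (Sum.inr ⟨b, h⟩), rfl⟩
    convert isInternal_freeSub_map hf Φ t ht htu using 1
    funext c
    rcases c with a | _ | b <;> rfl
  · rintro ⟨a, ha⟩
    refine exists_isNonSplitExact hd Φ hΦ a (k - a) (by omega) ?_ (fun c _ => hf c) (hr ⟨a, ha⟩) ?_
      (hκ a ha) ?_ (by push_cast [Nat.cast_sub ha.le]; ring)
    · rw [hlam, Nat.add_sub_cancel' ha.le]; push_cast; ring
    · rw [f1 a ha]; exact hFs a ha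
    · rw [f1 a ha, f2 a ha]; exact hGs a ha
  · exact ⟨(nonempty_equiv_freeLieSub_singleton Φ hΦ k (fun c _ => hf c) (hr1 k (Or.inl rfl))
      (hr0 k (Or.inl rfl))).some.symm⟩
  · intro b
    exact ⟨(nonempty_equiv_freeLieSub_singleton Φ hΦ b.1 (fun c _ => hf c)
      (hr1 b.1 (Or.inr b.2)) (hr0 b.1 (Or.inr b.2))).some.symm⟩

end Conformal

theorem mainTheorem2 (p q n : ℕ) (hp : 1 ≤ p) (hq : 2 ≤ q) (hpq : 4 < p + q)
    (hn : n + 2 = p + q) (k : ℕ) (hk : 1 ≤ k) :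
    Nonempty (Conformal.VermaG p n (Conformal.excParam n (2 * k + 1)) ≃ₗ⁅ℂ, Conformal.soG' p n⁆
      ⨁ b : ℕ, Conformal.VermaG' p n (Conformal.excParam n (2 * k + 1) - b)) ∧
    ∃ (M : Fin k → LieSubmodule ℂ (Conformal.soG' p n)
          (Conformal.VermaG p n (Conformal.excParam n (2 * k))))
      (A : LieSubmodule ℂ (Conformal.soG' p n)
          (Conformal.VermaG p n (Conformal.excParam n (2 * k))))
      (B : {b : ℕ // 2 * k + 1 ≤ b} → LieSubmodule ℂ (Conformal.soG' p n)
          (Conformal.VermaG p n (Conformal.excParam n (2 * k)))),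
      DirectSum.IsInternal
        (Sum.elim (fun a => (M a).toSubmodule)
          (Sum.elim (fun _ : Unit => A.toSubmodule) (fun b => (B b).toSubmodule))) ∧
      (∀ a : Fin k,
        ∃ (f : Conformal.VermaG' p n (Conformal.excParam n (2 * k) - (a : ℕ))
              →ₗ⁅ℂ, Conformal.soG' p n⁆ M a)
          (g : M a →ₗ⁅ℂ, Conformal.soG' p n⁆
              Conformal.VermaG' p n (Conformal.excParam n (2 * k) - (2 * (k : ℂ) - (a : ℕ)))),
          IsNonSplitExact f g) ∧
      Nonempty (A ≃ₗ⁅ℂ, Conformal.soG' p n⁆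
        Conformal.VermaG' p n (Conformal.excParam n (2 * k) - k)) ∧
      (∀ b, Nonempty (B b ≃ₗ⁅ℂ, Conformal.soG' p n⁆
        Conformal.VermaG' p n (Conformal.excParam n (2 * k) - (b : ℕ)))) := by
  -- Here `d = n - 1` counts the variables retained by 𝔤'; it is positive because `p + q > 4`, so `s
  -- ≠ 0`.
  obtain ⟨d, rfl⟩ : ∃ d, n = d + 1 := ⟨n - 1, by omega⟩
  exact ⟨Conformal.branching_odd p d k, Conformal.branching_even p d (by omega) k⟩
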